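/- **Setting.** For each sample size $n$ let $p=p_n$, let $\mathbf X\in\mathbb R^{n\times p}$ be a deterministic design, $\boldsymbol\beta^\star\in\mathbb R^p$ with non-empty support $\xi_\star=\{j:\beta^\star_j\neq 0\}$, $s=s_n=|\xi_\star|$, and $\mathbf Y=\mathbf X\boldsymbol\beta^\star+\sigma_\star\boldsymbol\varepsilon$ with $\boldsymbol\varepsilon\sim\mathcal N(\mathbf 0,\mathbf I_n)$ and $\sigma_\star>0$ fixed; $\mathbb P_\star$ is the law of $\mathbf Y$. Put $\epsilon_n=\sqrt{s\log p/n}$. A model $\xi\subseteq\{1,\dots,p\}$ is of full rank, written $\xi\in\mathcal F$, if the sub-matrix $\mathbf X_\xi$ of the columns in $\xi$ has rank $|\xi|$. Assume that for all large $n$: $p>n$, all columns satisfy $\|\mathbf X_j\|=\sqrt n$, and $\xi_\star\in\mathcal F$; and that $\epsilon_n\to0$. **Prior.** $\sigma^2$ has density $g$ over $(0,\infty)$; independently, $\xi$ has probability proportional to $\pi(\xi)1\{\xi\in\mathcal F\}$, where $\pi=\pi_n$ is a probability distribution on the subsets of $\{1,\dots,p\}$; given $(\sigma,\xi)$ the $\beta_j/\sigma$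 are independent, with law $h_0=h_{0n}$ (a probability measure on $\mathbb R$, possibly the Dirac measure at $0$) for $j\notin\xi$ and with density $h_1=h_{1n}$ for $j\in\xi$. $\Pi(\cdot\mid\mathbf X,\mathbf Y)$ is the resulting posterior distribution of $(\sigma,\xi,\boldsymbol\beta)$. Assume, with constants $A_1,A_2,A_3>0$: (a) $g$ is continuous and positive on $(0,\infty)$ and does not depend on $n$. (b) $\pi(\emptyset)\asymp1$, and for all large $n$, $\pi(\xi_\star)\ge p^{-A_1s}$ and $\sum_{\xi:|\xi|>t}\pi(\xi)\le p^{-A_2t}$ for all real $t\ge1$. (c) There is a sequence $z_{0n}$ with $h_0(\{z:|z|>z_{0n}\})\le e^{-n}$ for all large $n$ and $z_{0n}=o\big(p^{-1}\sqrt{\log p/n}\big)$. (d) With $z_{1n}=\max_{j\in\xi_\star}|\beta^\star_j/\sigma_\star|+\epsilon_n$, there is a $c>0$ with $\inf_{|z|\le z_{1n}}h_1(z)\ge c\,p^{-A_3}$ for all large $n$. **Eigenvalue condition.** For a constant $K\ge1$, the minimum united eigenvalue $$\lambda=\lambda_n:=\min_{\xi\in\mathcal F:\,|\xi\cup\xi_\star|\le(K+1)s}\lambda_{\min}\big(\mathbf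 X_{\xi\cup\xi_\star}^{\mathrm T}\mathbf X_{\xi\cup\xi_\star}/n\big)$$ is positive for all large $n$ (it may tend to $0$). **Theorem 1 (Posterior Contraction).** Suppose in addition that $A_1+A_3+1<A_2K$, and let $M_1,M_2>\sqrt{8\max\{A_2,1\}K}$ be constants. Let $\widehat\Theta$ be the set of all $(\sigma,\xi,\boldsymbol\beta)$ with $$\frac{\sigma^2}{\sigma_\star^2}\in\Big[\frac{1-M_1\epsilon_n}{1+M_1\epsilon_n},\frac{1+M_1\epsilon_n}{1-M_1\epsilon_n}\Big],\quad |\xi\setminus\xi_\star|\le Ks,\quad \xi\in\mathcal F,\quad \max_{j\notin\xi}|\beta_j|\le\sigma z_{0n},\quad \|\boldsymbol\beta-\boldsymbol\beta^\star\|_2\le\frac{M_2\sigma_\star\epsilon_n}{\sqrt\lambda}.$$ Then there are constants $C_1,C_2>0$, depending only on $A_1,A_2,A_3,K,M_1,M_2$, such that for all sufficiently large $n$ $$\mathbb P_\star\Big(\Pi(\widehat\Theta\mid\mathbf X,\mathbf Y)\ge1-e^{-C_1s\log p}\Big)\ge1-e^{-C_2s\log p}.$$ -/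

import Mathlib

open MeasureTheory ProbabilityTheory Filter Asymptotics Topology
open scoped NNReal ENNReal Matrix

namespace SpikeSlab

noncomputable section

/-! ### The linear model -/

/-- The index set `{j : β j ≠ 0}` of the non-zero coefficients. -/
def activeSet {p : ℕ} (β : Fin p → ℝ) : Finset (Fin p) :=
  Finset.univ.filter fun j => β j ≠ 0

/-- The rate `ε = √(s log p / n)`. -/
def rate (n p s : ℕ) : ℝ := Real.sqrt ((s : ℝ) * Real.log p / n)

/-- The sub-matrix of the columns of `X` indexed by the model `ξ`. -/
def cols {n p : ℕ} (X : Matrix (Fin n) (Fin p) ℝ) (ξ : Finset (Fin p)) :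
    Matrix (Fin n) ξ ℝ :=
  X.submatrix id fun j : ξ => (j : Fin p)

/-- The model `ξ` is of full rank: the columns of `X` indexed by `ξ` have rank `|ξ|`. -/
def FullRank {n p : ℕ} (X : Matrix (Fin n) (Fin p) ℝ) (ξ : Finset (Fin p)) : Prop :=
  (cols X ξ).rank = ξ.card

/-- The smallest eigenvalue of a (real symmetric) matrix. -/
def lambdaMin {ι : Type*} [Fintype ι] [DecidableEq ι] (A : Matrix ι ι ℝ) : ℝ :=
  sInf (spectrum ℝ A)

/-- The minimum united eigenvalue of order `t` of `X` with respect to the model `ξs`: the minimum,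
over the full-rank models `ξ` with `|ξ ∪ ξs| ≤ t`, of the smallest eigenvalue of the Gram matrix
of the columns in `ξ ∪ ξs`, divided by `n`. -/
def muev {n p : ℕ} (X : Matrix (Fin n) (Fin p) ℝ) (ξs : Finset (Fin p)) (t : ℝ) : ℝ :=
  ⨅ ξ : {ξ : Finset (Fin p) // FullRank X ξ ∧ ((ξ ∪ ξs).card : ℝ) ≤ t},
    lambdaMin ((n : ℝ)⁻¹ • ((cols X (ξ.1 ∪ ξs))ᵀ * cols X (ξ.1 ∪ ξs)))

/-- The law of `Y = X β + σ ε`, where `ε` is a standard normal vector in `ℝⁿ`. -/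
def dataLaw {n p : ℕ} (X : Matrix (Fin n) (Fin p) ℝ) (σ : ℝ) (β : Fin p → ℝ) :
    Measure (Fin n → ℝ) :=
  (Measure.pi fun _ : Fin n => gaussianReal 0 1).map fun e => X *ᵥ β + σ • e

/-! ### Prior and posterior -/

/-- `f` is a probability density function over the set `S ⊆ ℝ`. -/
structure IsDensityOn (S : Set ℝ) (f : ℝ → ℝ) : Prop where
  aemeasurable : AEMeasurable f (volume.restrict S)
  nonneg : ∀ x ∈ S, 0 ≤ f x
  lintegral_eq_one : ∫⁻ x in S, ENNReal.ofReal (f x) = 1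

/-- The measure on `S` with density `f`. -/
def densityLaw (S : Set ℝ) (f : ℝ → ℝ) : Measure ℝ :=
  (volume.restrict S).withDensity fun x => ENNReal.ofReal (f x)

/-- The parameter space: triples `(σ, ξ, β)`. -/
abbrev Param (p : ℕ) : Type := ℝ × Finset (Fin p) × (Fin p → ℝ)

instance finsetFinMeasurableSpace (p : ℕ) : MeasurableSpace (Finset (Fin p)) := ⊤

open Classical in
/-- The prior probability of the model `ξ`: proportional to `π ξ` on the full-rank models, and `0`
on all other models. -/
def modelWeight {n p : ℕ} (X : Matrix (Fin n) (Fin p) ℝ) (π : Finset (Fin p) → ℝ)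
    (ξ : Finset (Fin p)) : ℝ :=
  if FullRank X ξ then
    π ξ / ∑ γ ∈ Finset.univ.filter (fun γ : Finset (Fin p) => FullRank X γ), π γ
  else 0

/-- The joint law of the standardized coefficients `β j / σ` given the model `ξ`: they are
independent, with law `h₀` for `j ∉ ξ` and density `h₁` for `j ∈ ξ`. -/
def standardizedLaw {p : ℕ} (h₀ : Measure ℝ) (h₁ : ℝ → ℝ) (ξ : Finset (Fin p)) :
    Measure (Fin p → ℝ) :=
  Measure.pi fun j => if j ∈ ξ then densityLaw Set.univ h₁ else h₀

/-- The spike-and-slab prior of `(σ, ξ, β)`. The variance `v = σ²` has density `g` over `(0, ∞)`,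
the model `ξ` has probability `modelWeight X π ξ` and is independent of `v`, and given `(σ, ξ)` the
coefficients are `β j = σ z j` with `z` distributed according to `standardizedLaw h₀ h₁ ξ`. -/
def prior {n p : ℕ} (X : Matrix (Fin n) (Fin p) ℝ) (g : ℝ → ℝ) (π : Finset (Fin p) → ℝ)
    (h₀ : Measure ℝ) (h₁ : ℝ → ℝ) : Measure (Param p) :=
  ∑ ξ : Finset (Fin p), ENNReal.ofReal (modelWeight X π ξ) •
    ((densityLaw (Set.Ioi 0) g).prod (standardizedLaw h₀ h₁ ξ)).map
      fun vz : ℝ × (Fin p → ℝ) => (Real.sqrt vz.1, ξ, Real.sqrt vz.1 • vz.2)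

/-- The density at `Y` of the normal distribution with mean `X β` and covariance `σ² I`. -/
def likelihood {n p : ℕ} (X : Matrix (Fin n) (Fin p) ℝ) (Y : Fin n → ℝ) (θ : Param p) : ℝ≥0∞ :=
  ∏ i, gaussianPDF ((X *ᵥ θ.2.2) i) (θ.1 ^ 2).toNNReal (Y i)

/-- The posterior distribution given `Y`: the prior, weighted with the likelihood and normalized. -/
def posteriorLaw {n p : ℕ} (X : Matrix (Fin n) (Fin p) ℝ) (g : ℝ → ℝ) (π : Finset (Fin p) → ℝ)
    (h₀ : Measure ℝ) (h₁ : ℝ → ℝ) (Y : Fin n → ℝ) : Measure (Param p) :=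
  (((prior X g π h₀ h₁).withDensity (likelihood X Y)) Set.univ)⁻¹ •
    (prior X g π h₀ h₁).withDensity (likelihood X Y)

/-! ### Assumptions on the sequence of problems, indexed by the sample size `n` -/

/-- The number of non-zero true coefficients. -/
def sparsity {p : ℕ} (β : Fin p → ℝ) : ℕ := (activeSet β).card

/-- The standing assumptions on the design, the true coefficients and the regime. -/
structure Regime (p : ℕ → ℕ) (X : ∀ n, Matrix (Fin n) (Fin (p n)) ℝ)
    (β : ∀ n, Fin (p n) → ℝ) : Prop where
  lt_dim : ∀ᶠ n in atTop, n < p n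
  rate_tendsto : Tendsto (fun n => rate n (p n) (sparsity (β n))) atTop (𝓝 0)
  norm_col : ∀ᶠ n in atTop, ∀ j, ‖WithLp.toLp 2 ((X n)ᵀ j)‖ = Real.sqrt n
  nonempty : ∀ᶠ n in atTop, (activeSet (β n)).Nonempty
  fullRank : ∀ᶠ n in atTop, FullRank (X n) (activeSet (β n))

/-- The bound `z₁ = max_{j ∈ ξ⋆} |β⋆ j / σ⋆| + ε`. -/
def slabRadius (n : ℕ) {p : ℕ} (σs : ℝ) (β : Fin p → ℝ) : ℝ :=
  (((activeSet β).sup fun j => ‖β j / σs‖₊ : ℝ≥0) : ℝ) + rate n p (sparsity β)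

/-- The conditions on the spike-and-slab prior, with constants `A₁`, `A₂`, `A₃`. The variance prior
`g` does not depend on `n`; the model selection prior `π`, the spike distribution `h₀` and the slab
density `h₁` do. The spike may have atoms (it may be the Dirac measure at `0`), so that its tail
beyond `z₀` is required to be at most, rather than exactly, `exp (-n)`. -/
structure PriorAssumption (A₁ A₂ A₃ : ℝ) (p : ℕ → ℕ) (σs : ℝ) (β : ∀ n, Fin (p n) → ℝ)
    (g : ℝ → ℝ) (π : ∀ n, Finset (Fin (p n)) → ℝ) (h₀ : ℕ → Measure ℝ) (h₁ : ℕ → ℝ → ℝ)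
    (z₀ : ℕ → ℝ) : Prop where
  variance_density : IsDensityOn (Set.Ioi 0) g
  variance_continuous : ContinuousOn g (Set.Ioi 0)
  variance_pos : ∀ v, 0 < v → 0 < g v
  model_nonneg : ∀ n ξ, 0 ≤ π n ξ
  model_sum : ∀ n, ∑ ξ, π n ξ = 1
  model_empty : (fun n => π n ∅) =Θ[atTop] fun _ => (1 : ℝ)
  model_true : ∀ᶠ n in atTop, (p n : ℝ) ^ (-(A₁ * sparsity (β n))) ≤ π n (activeSet (β n))
  model_tail : ∀ᶠ n in atTop, ∀ t : ℝ, 1 ≤ t →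
    ∑ ξ ∈ Finset.univ.filter (fun ξ : Finset (Fin (p n)) => t < (ξ.card : ℝ)), π n ξ ≤
      (p n : ℝ) ^ (-(A₂ * t))
  spike_prob : ∀ n, IsProbabilityMeasure (h₀ n)
  spike_tail : ∀ᶠ n : ℕ in atTop, (h₀ n).real {z | z₀ n < |z|} ≤ Real.exp (-(n : ℝ))
  spike_rate : z₀ =o[atTop] fun n => 1 / (p n : ℝ) * Real.sqrt (Real.log (p n) / n)
  slab_density : ∀ n, IsDensityOn Set.univ (h₁ n)
  slab_lower : (fun n => (p n : ℝ) ^ (-A₃)) =O[atTop]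
    fun n => ⨅ z : {z : ℝ // |z| ≤ slabRadius n σs (β n)}, h₁ n z.1

/-- The set of `(σ, ξ, β)` on which the posterior concentrates. Here `ε` is the rate, `lam` is the
minimum united eigenvalue, and `σs`, `βs` are the true parameters. -/
def contractionSet {n p : ℕ} (X : Matrix (Fin n) (Fin p) ℝ) (σs : ℝ) (βs : Fin p → ℝ)
    (z₀ M₁ M₂ K lam ε : ℝ) : Set (Param p) :=
  {θ | θ.1 ^ 2 / σs ^ 2 ∈
        Set.Icc ((1 - M₁ * ε) / (1 + M₁ * ε)) ((1 + M₁ * ε) / (1 - M₁ * ε)) ∧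
      ((θ.2.1 \ activeSet βs).card : ℝ) ≤ K * sparsity βs ∧
      FullRank X θ.2.1 ∧
      (∀ j, j ∉ θ.2.1 → |θ.2.2 j| ≤ θ.1 * z₀) ∧
      ‖WithLp.toLp 2 (θ.2.2 - βs)‖ ≤ M₂ * σs * ε / Real.sqrt lam}

end

end SpikeSlab

open SpikeSlab

/-!
# Posterior contraction for generic spike-and-slab priors

Write `ε` for the rate, `L = n ε² = s log p`, and `B = max A₂ 1 * K`. A noise vector `e` is *good*
for a model `γ` if `‖e‖²` is within the factor `1 ± t ε` of `n` and the projection of `e` to the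
span of the columns in `γ` has squared norm at most `b² L` (`goodNoise`), where the constants are
chosen with `√(8B) < t < M₁` and `√(8B) < 2b < M₂`. By the Chernoff bound for chi-squared variables,
and since the dimension of that span is `O(s) = o(L)`, standard Gaussian noise fails to be good for
a given `γ` of size `O(s)` with probability at most `3 exp (-(B + τ) L)` for some `τ > 0`
(`stdGaussian_compl_goodNoise_le_exp`).

The proof rests on a deterministic fact (`mem_contractionSet_of_goodNoise`). Suppose the data are
explained both by the truth, as `Y = X β⋆ + σ⋆ e'`, and by a parameter of admissible model size and
with small inactive coefficients, as `Y = X β + σ e`, where both `e` and `e'` are good for the united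
model. Then the parameter lies in the contraction set. Indeed, orthogonally to the columns of the
united model the two noise vectors agree up to scale and a negligible term, which fixes `σ / σ⋆`;
within the column span, the signal `X (β - β⋆)` is a difference of two projected noise vectors, of
norm about `2 b σ⋆ √n ε` at most, and the minimum united eigenvalue turns this into a bound for
`‖β - β⋆‖`.

Let `T` be the event that the true noise is good for all united models of size at most `(K + 1) s`.
A union bound over at most `(K s + 1) p ^ (K s)` models shows that `T` has high probability under
the truth, while a parameter outside the contraction set, with an admissible model and small
inactive coefficients, gives `T` probability at most `3 exp (-(B + τ) L)`. Inadmissible models have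
prior mass `O(exp (-A₂ K L))`, and so do large inactive coefficients (`prior_model_le`,
`prior_spike_le`). On `T` the evidence is at least `exp (-(A₁ + A₃ + 1 + o(1)) L)` times the true
density (`exp_mul_likelihood_le_evidence`): the true model has prior mass at least `exp (-A₁ L)`, the
slab density contributes `exp (-A₃ L)`, and the volume of the neighbourhood of the truth on which the
likelihood ratio is at least `exp (-o(1) L)` contributes `exp (-L)`. Fubini's theorem and Markov's
inequality combine these bounds (`exists_posterior_bound`, `dataLaw_posterior_lt_le`), and the
condition `A₁ + A₃ + 1 < A₂ K` makes the quotient exponentially small.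
-/

namespace SpikeSlab

/-! ### Chi-squared tail bounds -/

theorem lintegral_exp_mul_sq_gaussianReal {u : ℝ} (hu : u < 1 / 2) :
    ∫⁻ x, ENNReal.ofReal (Real.exp (u * x ^ 2)) ∂(gaussianReal 0 1) =
      ENNReal.ofReal ((Real.sqrt (1 - 2 * u))⁻¹) := by
  have hpos : 0 < 1 - 2 * u := by linarith
  rw [gaussianReal_of_var_ne_zero 0 one_ne_zero,
    lintegral_withDensity_eq_lintegral_mul _ (measurable_gaussianPDF 0 1) (by fun_prop)]
  have h1 : ∀ x : ℝ, (gaussianPDF 0 1 * fun x => ENNReal.ofReal (Real.exp (u * x ^ 2))) x =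
      ENNReal.ofReal ((Real.sqrt (2 * Real.pi))⁻¹ * Real.exp (-(1 / 2 - u) * x ^ 2)) := by
    intro x
    simp only [Pi.mul_apply, gaussianPDF]
    rw [← ENNReal.ofReal_mul (gaussianPDFReal_nonneg _ _ _)]
    simp only [gaussianPDFReal, NNReal.coe_one, mul_one, sub_zero, mul_assoc]
    rw [← Real.exp_add]
    congr 3
    ring
  simp_rw [h1]
  rw [← ofReal_integral_eq_lintegral_ofReal
    ((integrable_exp_neg_mul_sq (by linarith : 0 < 1 / 2 - u)).const_mul _)
    (Eventually.of_forall fun x => by positivity), integral_const_mul, integral_gaussian]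
  congr 1
  rw [← Real.sqrt_inv, ← Real.sqrt_inv, ← Real.sqrt_mul (by positivity)]
  congr 1
  have : (1 / 2 - u) ≠ 0 := by linarith
  have h3 := Real.pi_ne_zero
  field_simp

theorem lintegral_prod_pi_gaussianReal {ι : Type*} [Fintype ι] {f : ℝ → ℝ≥0∞} (hf : Measurable f) :
    ∫⁻ x : ι → ℝ, ∏ i, f (x i) ∂(Measure.pi fun _ => gaussianReal 0 1) =
      (∫⁻ x, f x ∂(gaussianReal 0 1)) ^ Fintype.card ι := by
  have hind : iIndepFun (fun (i : ι) (x : ι → ℝ) => f (x i))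
      (Measure.pi fun _ : ι => gaussianReal 0 1) :=
    iIndepFun_pi (X := fun _ => f) fun _ => hf.aemeasurable
  rw [lintegral_prod_eq_prod_lintegral_of_indepFun Finset.univ _ hind
    (fun i => hf.comp (measurable_pi_apply i))]
  rw [Finset.prod_congr rfl (g := fun _ => ∫⁻ x, f x ∂(gaussianReal 0 1))]
  · simp
  · intro i _
    exact (measurePreserving_eval (fun _ : ι => gaussianReal 0 1) i).lintegral_comp hf

section StdGaussian

variable {E : Type*} [NormedAddCommGroup E] [InnerProductSpace ℝ E] [FiniteDimensional ℝ E]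
  [MeasurableSpace E] [BorelSpace E]

theorem lintegral_exp_mul_norm_sq_stdGaussian {u : ℝ} (hu : u < 1 / 2) :
    ∫⁻ x : E, ENNReal.ofReal (Real.exp (u * ‖x‖ ^ 2)) ∂(stdGaussian E) =
      ENNReal.ofReal ((Real.sqrt (1 - 2 * u))⁻¹) ^ Module.finrank ℝ E := by
  rw [stdGaussian, lintegral_map (by fun_prop) (by fun_prop)]
  have h1 : ∀ x : Fin (Module.finrank ℝ E) → ℝ,
      ENNReal.ofReal (Real.exp (u * ‖∑ i, x i • stdOrthonormalBasis ℝ E i‖ ^ 2)) =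
      ∏ i, ENNReal.ofReal (Real.exp (u * x i ^ 2)) := by
    intro x
    rw [← ENNReal.ofReal_prod_of_nonneg (fun _ _ => by positivity), ← Real.exp_sum,
      ← Finset.mul_sum]
    congr 3
    have := (stdOrthonormalBasis ℝ E).sum_sq_norm_inner_right
      (∑ i, x i • stdOrthonormalBasis ℝ E i)
    rw [← this]
    refine Finset.sum_congr rfl fun i _ => ?_
    rw [(stdOrthonormalBasis ℝ E).orthonormal.inner_right_fintype]
    simp
  simp_rw [h1]
  rw [lintegral_prod_pi_gaussianReal (f := fun x => ENNReal.ofReal (Real.exp (u * x ^ 2)))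
    (by fun_prop), lintegral_exp_mul_sq_gaussianReal hu, Fintype.card_fin]

/-- The orthogonal projection of a standard Gaussian vector is standard Gaussian. -/
theorem stdGaussian_map_orthogonalProjectionOnto (W : Submodule ℝ E) :
    (stdGaussian E).map W.orthogonalProjectionOnto = stdGaussian W := by
  apply Measure.ext_of_charFun
  ext t
  have : charFun ((stdGaussian E).map W.orthogonalProjectionOnto) t =
      charFun (stdGaussian E) (t : E) := by
    rw [charFun_apply, charFun_apply, integral_map (by fun_prop) (by fun_prop)]
    simp
  rw [this, charFun_stdGaussian, charFun_stdGaussian]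
  simp

/-- The Chernoff bound for the squared norm of a projection of a Gaussian vector, which has a
chi-squared law with as many degrees of freedom as the dimension of the subspace. -/
theorem stdGaussian_norm_starProjection_sq_gt_le (W : Submodule ℝ E) {u : ℝ} (hu0 : 0 ≤ u)
    (hu : u < 1 / 2) (r : ℝ) :
    stdGaussian E {x | r < ‖W.starProjection x‖ ^ 2} ≤
      ENNReal.ofReal (Real.exp (-(u * r)) * (Real.sqrt (1 - 2 * u))⁻¹ ^ Module.finrank ℝ W) := by
  have h1 : stdGaussian E {x | r < ‖W.starProjection x‖ ^ 2} = stdGaussian W {y | r < ‖y‖ ^ 2} := by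
    rw [← stdGaussian_map_orthogonalProjectionOnto, Measure.map_apply (by fun_prop)
      (measurableSet_lt (by fun_prop) (by fun_prop))]
    rfl
  rw [h1]
  calc stdGaussian W {y | r < ‖y‖ ^ 2}
      ≤ stdGaussian W {y | ENNReal.ofReal (Real.exp (u * r)) ≤
          ENNReal.ofReal (Real.exp (u * ‖y‖ ^ 2))} := by
        refine measure_mono fun y hy => ENNReal.ofReal_le_ofReal (Real.exp_le_exp.2 ?_)
        exact mul_le_mul_of_nonneg_left (le_of_lt hy) hu0
    _ ≤ (∫⁻ y, ENNReal.ofReal (Real.exp (u * ‖y‖ ^ 2)) ∂(stdGaussian W)) /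
          ENNReal.ofReal (Real.exp (u * r)) :=
        meas_ge_le_lintegral_div (by fun_prop) (by simp [Real.exp_pos]) (by simp)
    _ = _ := by
        rw [lintegral_exp_mul_norm_sq_stdGaussian hu, ← ENNReal.ofReal_pow (by positivity),
          ← ENNReal.ofReal_div_of_pos (Real.exp_pos _), Real.exp_neg, div_eq_inv_mul]

/-- The Chernoff bound for the lower tail of the chi-squared law. -/
theorem stdGaussian_norm_sq_lt_le {v : ℝ} (hv : 0 ≤ v) (r : ℝ) :
    stdGaussian E {x | ‖x‖ ^ 2 < r} ≤
      ENNReal.ofReal (Real.exp (v * r) * (Real.sqrt (1 + 2 * v))⁻¹ ^ Module.finrank ℝ E) := by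
  calc stdGaussian E {y | ‖y‖ ^ 2 < r}
      ≤ stdGaussian E {y | ENNReal.ofReal (Real.exp (-v * r)) ≤
          ENNReal.ofReal (Real.exp (-v * ‖y‖ ^ 2))} := by
        refine measure_mono fun y hy => ENNReal.ofReal_le_ofReal (Real.exp_le_exp.2 ?_)
        exact mul_le_mul_of_nonpos_left (le_of_lt hy) (by linarith)
    _ ≤ (∫⁻ y, ENNReal.ofReal (Real.exp (-v * ‖y‖ ^ 2)) ∂(stdGaussian E)) /
          ENNReal.ofReal (Real.exp (-v * r)) :=
        meas_ge_le_lintegral_div (by fun_prop) (by simp [Real.exp_pos]) (by simp)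
    _ = _ := by
        rw [lintegral_exp_mul_norm_sq_stdGaussian (by linarith), ← ENNReal.ofReal_pow (by positivity),
          ← ENNReal.ofReal_div_of_pos (Real.exp_pos _), div_eq_inv_mul, ← Real.exp_neg]
        ring_nf

end StdGaussian

theorem neg_log_one_sub_le {y : ℝ} (hy : |y| ≤ 1 / 2) :
    -Real.log (1 - y) ≤ y + y ^ 2 / 2 + 2 * |y| ^ 3 := by
  have h := Real.abs_log_sub_add_sum_range_le (x := y) (by linarith) 2
  have h2 : |y| ^ (2 + 1) / (1 - |y|) ≤ 2 * |y| ^ 3 := by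
    have h0 := abs_nonneg y
    generalize |y| = a at hy h0
    rw [div_le_iff₀ (by linarith), show 2 + 1 = 3 from rfl]
    have := mul_nonneg (pow_nonneg h0 3) (by linarith : 0 ≤ 1 / 2 - a)
    linarith
  have h3 := (abs_le.1 (h.trans h2)).1
  simp [Finset.sum_range_succ] at h3
  linarith

/-- The normalizing factor of the chi-squared moment generating function at `y / 2`, to second order.
Both signs of `y` occur, for the upper and for the lower tail. -/
theorem inv_sqrt_pow_le {y : ℝ} (hy : |y| ≤ 1 / 2) (n : ℕ) :
    (Real.sqrt (1 - y))⁻¹ ^ n ≤ Real.exp (n * (y / 2 + y ^ 2 / 4 + |y| ^ 3)) := by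
  have hpos : 0 < 1 - y := by linarith [le_abs_self y]
  have h : (Real.sqrt (1 - y))⁻¹ = Real.exp (-Real.log (1 - y) / 2) := by
    rw [Real.sqrt_eq_rpow, Real.rpow_def_of_pos hpos, ← Real.exp_neg]
    ring_nf
  rw [h, ← Real.exp_nat_mul]
  have := neg_log_one_sub_le hy
  gcongr
  linarith

/-- Concentration of the squared norm of a standard Gaussian vector about its dimension. -/
theorem gaussian_norm_sq_deviation_le {n : ℕ} {x : ℝ} (hx0 : 0 ≤ x) (hx : x ≤ 1 / 2) :
    stdGaussian (EuclideanSpace ℝ (Fin n)) {e | n * x < |‖e‖ ^ 2 - n|} ≤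
      ENNReal.ofReal (2 * Real.exp (-(n * x ^ 2 / 4 * (1 - 4 * x)))) := by
  have hup := stdGaussian_norm_starProjection_sq_gt_le (E := EuclideanSpace ℝ (Fin n)) ⊤
    (u := x / 2) (by linarith) (by linarith) (n * (1 + x))
  have hlo := stdGaussian_norm_sq_lt_le (E := EuclideanSpace ℝ (Fin n))
    (v := x / 2) (by linarith) (n * (1 - x))
  rw [finrank_top, finrank_euclideanSpace_fin] at hup
  rw [finrank_euclideanSpace_fin] at hlo
  have h1 : Real.exp (-(x / 2 * (n * (1 + x)))) * (Real.sqrt (1 - 2 * (x / 2)))⁻¹ ^ n ≤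
      Real.exp (-(n * x ^ 2 / 4 * (1 - 4 * x))) := by
    have := inv_sqrt_pow_le (y := x) (by rwa [abs_of_nonneg hx0]) n
    rw [abs_of_nonneg hx0] at this
    rw [show 2 * (x / 2) = x by ring]
    refine (mul_le_mul_of_nonneg_left this (Real.exp_pos _).le).trans (le_of_eq ?_)
    rw [← Real.exp_add]; congr 1; ring
  have h2 : Real.exp (x / 2 * (n * (1 - x))) * (Real.sqrt (1 + 2 * (x / 2)))⁻¹ ^ n ≤
      Real.exp (-(n * x ^ 2 / 4 * (1 - 4 * x))) := by
    have := inv_sqrt_pow_le (y := -x) (by rwa [abs_neg, abs_of_nonneg hx0]) n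
    rw [abs_neg, abs_of_nonneg hx0, sub_neg_eq_add] at this
    rw [show 2 * (x / 2) = x by ring]
    refine (mul_le_mul_of_nonneg_left this (Real.exp_pos _).le).trans (le_of_eq ?_)
    rw [← Real.exp_add]; congr 1; ring
  have hsub : {e : EuclideanSpace ℝ (Fin n) | n * x < |‖e‖ ^ 2 - n|} ⊆
      {e | n * (1 + x) < ‖(⊤ : Submodule ℝ (EuclideanSpace ℝ (Fin n))).starProjection e‖ ^ 2} ∪
      {e | ‖e‖ ^ 2 < n * (1 - x)} := by
    intro e he
    simp only [Set.mem_ofPred_eq, lt_abs] at he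
    rcases he with he | he
    · left
      simp only [Set.mem_ofPred_eq, Submodule.starProjection_top]
      simp; linarith
    · right
      simp only [Set.mem_ofPred_eq]; linarith
  refine (measure_mono hsub).trans ((measure_union_le _ _).trans ?_)
  rw [two_mul, ENNReal.ofReal_add (Real.exp_pos _).le (Real.exp_pos _).le]
  exact add_le_add (hup.trans (ENNReal.ofReal_le_ofReal h1))
    (hlo.trans (ENNReal.ofReal_le_ofReal h2))

/-! ### The likelihood and Bayes' theorem -/

theorem pi_gaussianReal_eq_withDensity {ι : Type*} [Fintype ι] (m : ι → ℝ) {v : ℝ≥0} (hv : v ≠ 0) :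
    Measure.pi (fun i => gaussianReal (m i) v) =
      (volume : Measure (ι → ℝ)).withDensity fun y => ∏ i, gaussianPDF (m i) v (y i) := by
  classical
  refine Measure.pi_eq fun s hs => ?_
  have hint : ∀ i, Integrable ((s i).indicator (gaussianPDFReal (m i) v)) := fun i =>
    (integrable_gaussianPDFReal (m i) v).indicator (hs i)
  have hnn : ∀ i x, 0 ≤ (s i).indicator (gaussianPDFReal (m i) v) x := fun i x =>
    Set.indicator_nonneg (fun _ _ => gaussianPDFReal_nonneg _ _ _) _
  have hpt : ∀ y : ι → ℝ, (Set.univ.pi s).indicator (fun y => ∏ i, gaussianPDF (m i) v (y i)) y =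
      ENNReal.ofReal (∏ i, (s i).indicator (gaussianPDFReal (m i) v) (y i)) := by
    intro y
    rw [ENNReal.ofReal_prod_of_nonneg fun i _ => hnn i _]
    by_cases hy : y ∈ Set.univ.pi s
    · rw [Set.indicator_of_mem hy]
      refine Finset.prod_congr rfl fun i _ => ?_
      rw [Set.indicator_of_mem (hy i trivial)]
      rfl
    · rw [Set.indicator_of_notMem hy]
      have : ∃ i, y i ∉ s i := by simpa [Set.mem_pi] using hy
      obtain ⟨i, hi⟩ := this
      refine (Finset.prod_eq_zero (Finset.mem_univ i) ?_).symm
      simp [hi]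
  rw [withDensity_apply _ (MeasurableSet.univ_pi hs), ← lintegral_indicator (MeasurableSet.univ_pi hs)]
  simp_rw [hpt]
  rw [volume_pi, ← ofReal_integral_eq_lintegral_ofReal (Integrable.fintype_prod hint)
    (Eventually.of_forall fun y => Finset.prod_nonneg fun i _ => hnn i _),
    integral_fintype_prod_eq_prod,
    ENNReal.ofReal_prod_of_nonneg fun i _ => integral_nonneg (hnn i)]
  refine Finset.prod_congr rfl fun i _ => ?_
  rw [integral_indicator (hs i), gaussianReal_apply_eq_integral _ hv]

variable {n p : ℕ} (X : Matrix (Fin n) (Fin p) ℝ)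

/-- The likelihood is the density of the data. The model `ξ` is a free parameter, since the likelihood
depends on the scale and the coefficients only. -/
theorem dataLaw_eq_withDensity {σ : ℝ} (hσ : 0 < σ) (ξ : Finset (Fin p)) (β : Fin p → ℝ) :
    dataLaw X σ β = volume.withDensity fun Y => likelihood X Y (σ, ξ, β) := by
  have hv : (σ ^ 2).toNNReal ≠ 0 := by
    rw [Ne, Real.toNNReal_eq_zero, not_le]; positivity
  simp only [likelihood]
  rw [← pi_gaussianReal_eq_withDensity _ hv, dataLaw]
  have h : ∀ i, (gaussianReal 0 1).map (fun x => (X *ᵥ β) i + σ * x) =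
      gaussianReal ((X *ᵥ β) i) (σ ^ 2).toNNReal := by
    intro i
    have : (fun x => (X *ᵥ β) i + σ * x) = (fun x => (X *ᵥ β) i + x) ∘ (fun x => σ * x) := rfl
    rw [this, ← Measure.map_map (by fun_prop) (by fun_prop), gaussianReal_map_const_mul,
      gaussianReal_map_const_add]
    congr 1
    · simp
    · ext; simp [sq_nonneg]
  have : ∀ i, SigmaFinite ((gaussianReal 0 1).map fun x => (X *ᵥ β) i + σ * x) := fun i => by
    rw [h]; infer_instance
  have h2 := Measure.pi_map_pi (μ := fun _ : Fin n => gaussianReal 0 1)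
    (f := fun i x => (X *ᵥ β) i + σ * x) (fun i => by fun_prop)
  simp_rw [h] at h2
  exact h2

theorem isProbabilityMeasure_dataLaw (σ : ℝ) (β : Fin p → ℝ) :
    IsProbabilityMeasure (dataLaw X σ β) :=
  Measure.isProbabilityMeasure_map (by fun_prop)

theorem dataLaw_apply {σ : ℝ} {β : Fin p → ℝ} {A : Set (Fin n → ℝ)} (hA : MeasurableSet A) :
    dataLaw X σ β A =
      stdGaussian (EuclideanSpace ℝ (Fin n)) {e | X *ᵥ β + σ • e.ofLp ∈ A} := by
  rw [dataLaw, Measure.map_apply (by fun_prop) hA, ← map_pi_eq_stdGaussian,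
    Measure.map_apply (by fun_prop)]
  · rfl
  · exact (by fun_prop : Measurable fun e : EuclideanSpace ℝ (Fin n) => X *ᵥ β + σ • e.ofLp) hA

theorem measurable_likelihood :
    Measurable fun q : (Fin n → ℝ) × Param p => likelihood X q.1 q.2 := by
  unfold likelihood
  refine Finset.measurable_prod _ fun i _ => ?_
  have : Measurable fun q : (Fin n → ℝ) × Param p =>
      ((X *ᵥ q.2.2.2) i, (q.2.1 ^ 2).toNNReal, q.1 i) := by
    refine Measurable.prodMk ?_ (Measurable.prodMk (by fun_prop) (by fun_prop))
    simp only [Matrix.mulVec, dotProduct]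
    fun_prop
  exact measurable_uncurry_gaussianPDF.comp this

theorem measurable_likelihood_right (Y : Fin n → ℝ) : Measurable (likelihood X Y) :=
  Measurable.of_uncurry_left (f := likelihood X) (measurable_likelihood X)

theorem measurable_likelihood_left (θ : Param p) : Measurable fun Y => likelihood X Y θ :=
  Measurable.of_uncurry_right (f := likelihood X) (measurable_likelihood X)

theorem likelihood_ne_zero (Y : Fin n → ℝ) {θ : Param p} (h : 0 < θ.1) : likelihood X Y θ ≠ 0 := by
  refine Finset.prod_ne_zero_iff.2 fun i _ => (gaussianPDF_pos _ ?_ _).ne'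
  rw [Ne, Real.toNNReal_eq_zero, not_le]; positivity

theorem likelihood_eq (Y : Fin n → ℝ) {θ : Param p} (h : 0 < θ.1) :
    likelihood X Y θ = ENNReal.ofReal ((Real.sqrt (2 * Real.pi) * θ.1)⁻¹ ^ n *
      Real.exp (-(‖WithLp.toLp 2 (Y - X *ᵥ θ.2.2)‖ ^ 2 / (2 * θ.1 ^ 2)))) := by
  simp only [likelihood, gaussianPDF, gaussianPDFReal]
  rw [← ENNReal.ofReal_prod_of_nonneg fun i _ => by positivity, Finset.prod_mul_distrib,
    ← Real.exp_sum, EuclideanSpace.real_norm_sq_eq]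
  congr 2
  · rw [Finset.prod_const, Finset.card_univ, Fintype.card_fin, Real.coe_toNNReal _ (by positivity),
      Real.sqrt_mul (by positivity), Real.sqrt_sq h.le]
  · rw [Finset.sum_div, ← Finset.sum_neg_distrib]
    congr 1
    refine Finset.sum_congr rfl fun i _ => ?_
    rw [Real.coe_toNNReal _ (by positivity)]
    simp [neg_div]

section Bayes

variable {𝓨 Θ : Type*} [MeasurableSpace 𝓨] [MeasurableSpace Θ]

/-- If on `T` the evidence is at least `κ` times the true density, then the posterior probability
of `B` is at most `δ` outside an event whose probability is governed by the average over the
prior, restricted to `B`, of the probability of `T`. -/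
theorem exists_posterior_bound {ν : Measure 𝓨} [SFinite ν] {Q : Measure Θ} [IsFiniteMeasure Q]
    {ℓ : 𝓨 → Θ → ℝ≥0∞} (hℓ : Measurable (Function.uncurry ℓ)) {ℓs : 𝓨 → ℝ≥0∞}
    (hℓs : Measurable ℓs) (hs0 : ∀ y, ℓs y ≠ 0)
    {B : Set Θ} {T : Set 𝓨} (hT : MeasurableSet T) {κ δ b : ℝ≥0∞}
    (hκ0 : κ ≠ 0) (hκt : κ ≠ ∞) (hδ0 : δ ≠ 0) (hδt : δ ≠ ∞)
    (hlow : ∀ y ∈ T, κ * ℓs y ≤ ∫⁻ θ, ℓ y θ ∂Q)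
    (hnum : ∫⁻ θ in B, ∫⁻ y in T, ℓ y θ ∂ν ∂Q ≤ b)
    (htot : ∫⁻ θ, ∫⁻ y, ℓ y θ ∂ν ∂Q ≠ ∞) :
    ν.withDensity ℓs {y | y ∈ T ∧ ¬ ((∫⁻ θ, ℓ y θ ∂Q) ≠ ∞ ∧ (∫⁻ θ, ℓ y θ ∂Q) ≠ 0 ∧
      (∫⁻ θ in B, ℓ y θ ∂Q) ≤ δ * ∫⁻ θ, ℓ y θ ∂Q)} ≤ b / (δ * κ) := by
  -- `Z` is the evidence, which is finite for almost all data by Fubini's theorem, and `N` is the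
  -- unnormalized posterior mass of `B`.
  set Z : 𝓨 → ℝ≥0∞ := fun y => ∫⁻ θ, ℓ y θ ∂Q with hZ
  set N : 𝓨 → ℝ≥0∞ := fun y => ∫⁻ θ in B, ℓ y θ ∂Q with hN
  have hZm : Measurable Z := hℓ.lintegral_prod_right
  have hNm : Measurable N := hℓ.lintegral_prod_right
  have hZfin : ∀ᵐ y ∂ν, Z y < ∞ := by
    refine ae_lt_top hZm ?_
    rw [lintegral_lintegral_swap hℓ.aemeasurable]
    exact htot
  have hac : ν.withDensity ℓs ≪ ν := withDensity_absolutelyContinuous _ _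
  have hZ0 : ν.withDensity ℓs {y | ¬ Z y < ∞} = 0 := hac (ae_iff.1 hZfin)
  set S : Set 𝓨 := T ∩ {y | δ * κ * ℓs y ≤ N y} with hS
  have hSm : MeasurableSet S := hT.inter (measurableSet_le (by fun_prop) hNm)
  have hdk0 : δ * κ ≠ 0 := mul_ne_zero hδ0 hκ0
  have hdkt : δ * κ ≠ ∞ := ENNReal.mul_ne_top hδt hκt
  have hsub : {y | y ∈ T ∧ ¬ (Z y ≠ ∞ ∧ Z y ≠ 0 ∧ N y ≤ δ * Z y)} ⊆ {y | ¬ Z y < ∞} ∪ S := by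
    rintro y ⟨hyT, hy⟩
    by_cases hfin : Z y < ∞
    · right
      refine ⟨hyT, ?_⟩
      by_contra hlt
      simp only [Set.mem_ofPred_eq, not_le] at hlt
      have h1 := hlow y hyT
      apply hy
      refine ⟨hfin.ne, ?_, hlt.le.trans ?_⟩
      · intro h0
        rw [show (∫⁻ θ, ℓ y θ ∂Q) = Z y from rfl, h0] at h1
        exact mul_ne_zero hκ0 (hs0 y) (le_antisymm h1 bot_le)
      · rw [mul_assoc]; gcongr
    · left; exact hfin
  refine (measure_mono hsub).trans ((measure_union_le _ _).trans ?_)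
  rw [hZ0, zero_add, withDensity_apply _ hSm, ENNReal.le_div_iff_mul_le (Or.inl hdk0) (Or.inl hdkt),
    mul_comm, ← lintegral_const_mul _ hℓs]
  calc ∫⁻ y in S, δ * κ * ℓs y ∂ν ≤ ∫⁻ y in S, N y ∂ν :=
        setLIntegral_mono hNm fun y hy => hy.2
    _ ≤ ∫⁻ y in T, N y ∂ν := lintegral_mono_set Set.inter_subset_left
    _ = ∫⁻ θ in B, ∫⁻ y in T, ℓ y θ ∂ν ∂Q := lintegral_lintegral_swap hℓ.aemeasurable
    _ ≤ b := hnum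

end Bayes

/-! ### Column spans and the minimum united eigenvalue -/

/-- The Rayleigh quotient is bounded below by the smallest eigenvalue. -/
theorem lambdaMin_mul_dotProduct_le {ι : Type*} [Fintype ι] [DecidableEq ι] {A : Matrix ι ι ℝ}
    (hA : A.IsHermitian) (v : ι → ℝ) : lambdaMin A * (v ⬝ᵥ v) ≤ v ⬝ᵥ A *ᵥ v := by
  have hpsd : (A - algebraMap ℝ (Matrix ι ι ℝ) (lambdaMin A)).PosSemidef := by
    rw [Matrix.posSemidef_iff_isHermitian_and_spectrum_nonneg]
    refine ⟨hA.sub (Matrix.isHermitian_diagonal _), ?_⟩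
    rw [← spectrum.sub_singleton_eq]
    rintro x ⟨μ, hμ, l, rfl, rfl⟩
    have : sInf (spectrum ℝ A) ≤ μ := csInf_le (Matrix.finite_real_spectrum).bddBelow hμ
    simpa [lambdaMin] using this
  have h := hpsd.dotProduct_mulVec_nonneg v
  rw [Matrix.sub_mulVec, dotProduct_sub, Algebra.algebraMap_eq_smul_one, Matrix.smul_mulVec,
    Matrix.one_mulVec, dotProduct_smul] at h
  simpa using h

section Design

variable {n p : ℕ} (X : Matrix (Fin n) (Fin p) ℝ)

/-- The subspace of `ℝⁿ` spanned by the columns of `X` indexed by `γ`. -/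
def colSpan (γ : Finset (Fin p)) : Submodule ℝ (EuclideanSpace ℝ (Fin n)) :=
  Submodule.span ℝ ((fun j => WithLp.toLp 2 (Xᵀ j)) '' (γ : Set (Fin p)))

theorem finrank_colSpan_le (γ : Finset (Fin p)) :
    Module.finrank ℝ (colSpan X γ) ≤ γ.card := by
  classical
  have h := finrank_span_finset_le_card (R := ℝ)
    (γ.image fun j => (WithLp.toLp 2 (Xᵀ j) : EuclideanSpace ℝ (Fin n)))
  rw [Finset.coe_image] at h
  exact h.trans Finset.card_image_le

theorem toLp_mulVec_eq_sum (v : Fin p → ℝ) :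
    (WithLp.toLp 2 (X *ᵥ v) : EuclideanSpace ℝ (Fin n)) = ∑ j, v j • WithLp.toLp 2 (Xᵀ j) := by
  ext i
  simp [Matrix.mulVec, dotProduct, mul_comm]

theorem toLp_mulVec_mem_colSpan {γ : Finset (Fin p)} {v : Fin p → ℝ} (hv : ∀ j, j ∉ γ → v j = 0) :
    (WithLp.toLp 2 (X *ᵥ v) : EuclideanSpace ℝ (Fin n)) ∈ colSpan X γ := by
  rw [toLp_mulVec_eq_sum]
  refine Submodule.sum_mem _ fun j _ => ?_
  by_cases hj : j ∈ γ
  · exact Submodule.smul_mem _ _ (Submodule.subset_span ⟨j, hj, rfl⟩)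
  · simp [hv j hj]

/-- Nothing better than the `ℓ¹` norm is used for vectors that are not sparse: this is why the spike
has to be narrower than the rate by a factor `p`. -/
theorem norm_toLp_mulVec_le {c : ℝ} (hcol : ∀ j, ‖WithLp.toLp 2 (Xᵀ j)‖ = c) (v : Fin p → ℝ) :
    ‖(WithLp.toLp 2 (X *ᵥ v) : EuclideanSpace ℝ (Fin n))‖ ≤ c * ∑ j, |v j| := by
  rw [toLp_mulVec_eq_sum, Finset.mul_sum]
  refine (norm_sum_le _ _).trans (Finset.sum_le_sum fun j _ => ?_)
  rw [norm_smul, hcol, Real.norm_eq_abs, mul_comm]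

/-- The minimum united eigenvalue bounds the design from below on vectors supported in the union
of a full-rank model with the distinguished model. -/
theorem muev_mul_norm_sq_le (hn : 0 < n) {ξ ξs : Finset (Fin p)} {t : ℝ} (hξ : FullRank X ξ)
    (ht : ((ξ ∪ ξs).card : ℝ) ≤ t) {v : Fin p → ℝ} (hv : ∀ j, j ∉ ξ ∪ ξs → v j = 0) :
    n * muev X ξs t * ‖WithLp.toLp 2 v‖ ^ 2 ≤ ‖WithLp.toLp 2 (X *ᵥ v)‖ ^ 2 := by
  set γ := ξ ∪ ξs with hγ
  set G := (n : ℝ)⁻¹ • ((cols X γ)ᵀ * cols X γ) with hG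
  have h1 : muev X ξs t ≤ lambdaMin G :=
    ciInf_le (Set.finite_range _).bddBelow
      (⟨ξ, hξ, ht⟩ : {ξ : Finset (Fin p) // FullRank X ξ ∧ ((ξ ∪ ξs).card : ℝ) ≤ t})
  have hGh : G.IsHermitian := by
    have h : ((cols X γ)ᵀ * cols X γ).IsHermitian := Matrix.isHermitian_conjTranspose_mul_self _
    rw [hG, Matrix.IsHermitian, Matrix.conjTranspose_smul, h.eq]
    simp
  set w : γ → ℝ := fun j => v j with hw
  have h2 := lambdaMin_mul_dotProduct_le hGh w
  have hmul : cols X γ *ᵥ w = X *ᵥ v := by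
    ext i
    simp only [Matrix.mulVec, dotProduct, cols, Matrix.submatrix_apply, id, hw]
    rw [Finset.sum_coe_sort γ fun j => X i j * v j]
    exact Finset.sum_subset (Finset.subset_univ _) fun j _ hj => by simp [hv j hj]
  have hnorm : w ⬝ᵥ w = ‖WithLp.toLp 2 v‖ ^ 2 := by
    rw [EuclideanSpace.real_norm_sq_eq]
    simp only [dotProduct, hw, ← sq]
    rw [Finset.sum_coe_sort γ fun j => v j ^ 2]
    exact Finset.sum_subset (Finset.subset_univ _) fun j _ hj => by simp [hv j hj]
  have hquad : w ⬝ᵥ G *ᵥ w = (n : ℝ)⁻¹ * ‖WithLp.toLp 2 (X *ᵥ v)‖ ^ 2 := by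
    rw [hG, Matrix.smul_mulVec, dotProduct_smul, ← Matrix.mulVec_mulVec, Matrix.dotProduct_mulVec,
      Matrix.vecMul_transpose, hmul, EuclideanSpace.real_norm_sq_eq, smul_eq_mul]
    simp [dotProduct, sq]
  rw [hnorm, hquad] at h2
  have hn' : (0 : ℝ) < n := by exact_mod_cast hn
  calc n * muev X ξs t * ‖WithLp.toLp 2 v‖ ^ 2
      = n * (muev X ξs t * ‖WithLp.toLp 2 v‖ ^ 2) := by ring
    _ ≤ n * (lambdaMin G * ‖WithLp.toLp 2 v‖ ^ 2) := by gcongr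
    _ ≤ n * ((n : ℝ)⁻¹ * ‖WithLp.toLp 2 (X *ᵥ v)‖ ^ 2) := by gcongr
    _ = _ := by field_simp

/-- Since the columns have norm `√n`, the minimum united eigenvalue is at most `1`. -/
theorem muev_le_one (hn : 0 < n) (hcol : ∀ j, ‖WithLp.toLp 2 (Xᵀ j)‖ = Real.sqrt n)
    {ξs : Finset (Fin p)} {t : ℝ} (hξ : FullRank X ξs) (ht : (ξs.card : ℝ) ≤ t)
    (hne : ξs.Nonempty) : muev X ξs t ≤ 1 := by
  classical
  obtain ⟨j, hj⟩ := hne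
  have hn' : (0 : ℝ) < n := by exact_mod_cast hn
  have h := muev_mul_norm_sq_le X hn (ξ := ξs) (ξs := ξs) (t := t) hξ (by simpa using ht)
    (v := Pi.single j 1) (fun i hi => by
      have : i ≠ j := by rintro rfl; simp [hj] at hi
      simp [this])
  have h1 : ‖(WithLp.toLp 2 (Pi.single j (1 : ℝ)) : EuclideanSpace ℝ (Fin p))‖ = 1 := by
    simp
  have h2 : X *ᵥ Pi.single j 1 = Xᵀ j := by
    ext i; simp
  rw [h1, h2, hcol, Real.sq_sqrt hn'.le] at h
  nlinarith

/-- The noise vectors whose squared norm is within a relative error `x` of its mean `n`, and whose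
projection to the span of the columns in `γ` has squared norm at most `r`. -/
def goodNoise (γ : Finset (Fin p)) (x r : ℝ) : Set (EuclideanSpace ℝ (Fin n)) :=
  {e | |‖e‖ ^ 2 - n| ≤ n * x ∧ ‖(colSpan X γ).starProjection e‖ ^ 2 ≤ r}

theorem measurableSet_goodNoise (γ : Finset (Fin p)) (x r : ℝ) :
    MeasurableSet (goodNoise X γ x r) :=
  MeasurableSet.inter
    (measurableSet_le (f := fun e : EuclideanSpace ℝ (Fin n) => |‖e‖ ^ 2 - n|)
      (by fun_prop) measurable_const)
    (measurableSet_le (f := fun e => ‖(colSpan X γ).starProjection e‖ ^ 2)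
      (by fun_prop) measurable_const)

theorem stdGaussian_proj_gt_le (γ : Finset (Fin p)) {r u : ℝ} (hu0 : 0 ≤ u) (hu : u < 1 / 2) :
    stdGaussian (EuclideanSpace ℝ (Fin n)) {e | r < ‖(colSpan X γ).starProjection e‖ ^ 2} ≤
      ENNReal.ofReal (Real.exp (-(u * r)) * (Real.sqrt (1 - 2 * u))⁻¹ ^ γ.card) := by
  refine (stdGaussian_norm_starProjection_sq_gt_le _ hu0 hu r).trans (ENNReal.ofReal_le_ofReal ?_)
  have : 1 ≤ (Real.sqrt (1 - 2 * u))⁻¹ := by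
    rw [one_le_inv₀ (Real.sqrt_pos.2 (by linarith)), Real.sqrt_le_one]
    linarith
  gcongr
  exact finrank_colSpan_le X γ

theorem stdGaussian_compl_goodNoise_le (γ : Finset (Fin p)) {x r u : ℝ} (hx0 : 0 ≤ x)
    (hx : x ≤ 1 / 2) (hu0 : 0 ≤ u) (hu : u < 1 / 2) :
    stdGaussian (EuclideanSpace ℝ (Fin n)) (goodNoise X γ x r)ᶜ ≤
      ENNReal.ofReal (2 * Real.exp (-(n * x ^ 2 / 4 * (1 - 4 * x))) +
        Real.exp (-(u * r)) * (Real.sqrt (1 - 2 * u))⁻¹ ^ γ.card) := by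
  have hsub : (goodNoise X γ x r)ᶜ ⊆ {e | n * x < |‖e‖ ^ 2 - n|} ∪
      {e | r < ‖(colSpan X γ).starProjection e‖ ^ 2} := by
    intro e he
    simp only [goodNoise, Set.mem_compl_iff, Set.mem_ofPred_eq, not_and_or, not_le] at he
    exact he
  rw [ENNReal.ofReal_add (by positivity) (by positivity)]
  exact (measure_mono hsub).trans ((measure_union_le _ _).trans
    (add_le_add (gaussian_norm_sq_deviation_le hx0 hx) (stdGaussian_proj_gt_le X γ hu0 hu)))

end Design

section Geometry

variable {E : Type*} [NormedAddCommGroup E] [InnerProductSpace ℝ E]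

theorem norm_sq_eq_starProjection (W : Submodule ℝ E) [W.HasOrthogonalProjection] (x : E) :
    ‖x - W.starProjection x‖ ^ 2 = ‖x‖ ^ 2 - ‖W.starProjection x‖ ^ 2 := by
  have h := W.norm_sq_eq_add_norm_sq_starProjection x
  rw [Submodule.starProjection_orthogonal_val] at h
  linarith

/-- Two scaled noise vectors that differ by a vector `m` of `W`, up to a small perturbation `δ`,
have comparable scales: outside `W` they agree, and there both norms are close to `√N`. -/
theorem scale_ratio_mem (W : Submodule ℝ E) [W.HasOrthogonalProjection] {e e' δ m : E}
    {N x y r d σ σs : ℝ} (hN : 0 < N) (hx : x ≤ 1)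
    (he : |‖e‖ ^ 2 - N| ≤ N * x) (he' : |‖e'‖ ^ 2 - N| ≤ N * x)
    (hr : ‖W.starProjection e‖ ^ 2 ≤ r) (hr' : ‖W.starProjection e'‖ ^ 2 ≤ r)
    (hd : ‖δ‖ ≤ d) (hm : m ∈ W) (hσ : 0 < σ) (hσs : 0 < σs)
    (heq : m + σ • δ + σ • e = σs • e')
    (hy : N * x + r + 4 * d * Real.sqrt N + d ^ 2 ≤ N * y) (hy1 : y < 1) :
    σ ^ 2 / σs ^ 2 ∈ Set.Icc ((1 - y) / (1 + y)) ((1 + y) / (1 - y)) := by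
  -- Outside `W` the signal disappears: `σ (Q e + Q δ) = σs Q e'`.
  set Q : E → E := fun z => z - W.starProjection z with hQ
  have hd0 : 0 ≤ d := (norm_nonneg _).trans hd
  have hr0 : 0 ≤ r := (sq_nonneg _).trans hr
  have hsN : 0 < Real.sqrt N := Real.sqrt_pos.2 hN
  have hsN2 : Real.sqrt N ^ 2 = N := Real.sq_sqrt hN.le
  rw [abs_le] at he he'
  have hQe := norm_sq_eq_starProjection W e
  have hQe' := norm_sq_eq_starProjection W e'
  have hQδ : ‖Q δ‖ ≤ d := by
    have h := norm_sq_eq_starProjection W δ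
    refine le_trans ?_ hd
    refine abs_le_of_sq_le_sq' ?_ (norm_nonneg _) |>.2
    rw [hQ]; nlinarith [sq_nonneg ‖W.starProjection δ‖]
  have hQeq : σ • (Q e + Q δ) = σs • Q e' := by
    have hP := congrArg W.starProjection heq
    simp only [map_add, map_smul] at hP
    rw [Submodule.starProjection_eq_self_iff.2 hm] at hP
    simp only [hQ, smul_add, smul_sub, ← heq, ← hP]
    abel
  set c := ‖Q e + Q δ‖ with hc
  set a := ‖Q e'‖ with ha
  have hca : σ * c = σs * a := by
    have := congrArg norm hQeq
    rwa [norm_smul, norm_smul, Real.norm_of_nonneg hσ.le, Real.norm_of_nonneg hσs.le] at this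
  set q := ‖Q e‖ with hq
  have hq0 : 0 ≤ q := norm_nonneg _
  have hq2 : q ^ 2 = ‖e‖ ^ 2 - ‖W.starProjection e‖ ^ 2 := hQe
  have ha2 : a ^ 2 = ‖e'‖ ^ 2 - ‖W.starProjection e'‖ ^ 2 := hQe'
  have hq_le : q ≤ 2 * Real.sqrt N := by
    refine abs_le_of_sq_le_sq' ?_ (by positivity) |>.2
    nlinarith [sq_nonneg ‖W.starProjection e‖]
  have hc_le : c ≤ q + d := (norm_add_le _ _).trans (by linarith)
  have hc_ge : q - d ≤ c := by
    have := norm_sub_le (Q e + Q δ) (Q δ)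
    rw [add_sub_cancel_right] at this
    linarith
  have hc0 : 0 ≤ c := norm_nonneg _
  have hqd : q * d ≤ 2 * Real.sqrt N * d := mul_le_mul_of_nonneg_right hq_le hd0
  have hdN : 0 ≤ d * Real.sqrt N := by positivity
  have hcu : c ^ 2 ≤ N * (1 + y) := by
    have : c ^ 2 ≤ (q + d) ^ 2 := by gcongr
    linarith [sq_nonneg ‖W.starProjection e‖]
  have hcl : N * (1 - y) ≤ c ^ 2 := by
    have : q ^ 2 - 2 * (q * d) ≤ c ^ 2 := by
      rcases le_total d q with h | h
      · have h1 : (q - d) ^ 2 ≤ c ^ 2 := by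
          have := sub_nonneg.2 h
          gcongr
        linarith [sq_nonneg d]
      · have h1 : q * q ≤ q * d := mul_le_mul_of_nonneg_left h hq0
        have h2 : 0 ≤ q * d := mul_nonneg hq0 hd0
        linarith [sq_nonneg c]
    linarith [sq_nonneg d]
  have hau : a ^ 2 ≤ N * (1 + y) := by
    linarith [sq_nonneg ‖W.starProjection e'‖, sq_nonneg d]
  have hal : N * (1 - y) ≤ a ^ 2 := by
    linarith [sq_nonneg d]
  have h1y : 0 < 1 - y := by linarith
  have hy' : 0 < 1 + y := by
    have : 0 < N * (1 - y) := by positivity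
    have : 0 < N * (1 + y) := by linarith
    exact (mul_pos_iff_of_pos_left hN).1 this
  have hsq : σ ^ 2 * c ^ 2 = σs ^ 2 * a ^ 2 := by
    rw [← mul_pow, ← mul_pow, hca]
  have hs2 : 0 < σ ^ 2 := by positivity
  have hss2 : 0 < σs ^ 2 := by positivity
  have hA : σ ^ 2 * (N * (1 - y)) ≤ σs ^ 2 * (N * (1 + y)) := by
    calc σ ^ 2 * (N * (1 - y)) ≤ σ ^ 2 * c ^ 2 := by gcongr
      _ = σs ^ 2 * a ^ 2 := hsq
      _ ≤ _ := by gcongr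
  have hB : σs ^ 2 * (N * (1 - y)) ≤ σ ^ 2 * (N * (1 + y)) := by
    calc σs ^ 2 * (N * (1 - y)) ≤ σs ^ 2 * a ^ 2 := by gcongr
      _ = σ ^ 2 * c ^ 2 := hsq.symm
      _ ≤ _ := by gcongr
  constructor
  · rw [div_le_div_iff₀ hy' hss2]
    exact le_of_mul_le_mul_left (by linarith) hN
  · rw [div_le_div_iff₀ hss2 h1y]
    exact le_of_mul_le_mul_left (by linarith) hN

/-- The component `m` of the signal in `W` is a difference of two projected noise vectors, up to the
perturbation `δ`. -/
theorem norm_signal_le (W : Submodule ℝ E) [W.HasOrthogonalProjection] {e e' δ m : E}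
    {R d σ σs : ℝ} (hr : ‖W.starProjection e‖ ≤ R) (hr' : ‖W.starProjection e'‖ ≤ R)
    (hd : ‖δ‖ ≤ d) (hm : m ∈ W) (hσ : 0 < σ) (hσs : 0 < σs)
    (heq : m + σ • δ + σ • e = σs • e') : ‖m‖ ≤ σs * R + σ * (R + d) := by
  have hP := congrArg W.starProjection heq
  simp only [map_add, map_smul] at hP
  rw [Submodule.starProjection_eq_self_iff.2 hm] at hP
  have h1 : m = σs • W.starProjection e' - σ • (W.starProjection e + W.starProjection δ) := by
    rw [← hP, smul_add]; abel
  have hPδ : ‖W.starProjection δ‖ ≤ d := (W.norm_starProjection_apply_le δ).trans hd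
  rw [h1]
  refine (norm_sub_le _ _).trans ?_
  rw [norm_smul, norm_smul, Real.norm_of_nonneg hσ.le, Real.norm_of_nonneg hσs.le]
  have := norm_add_le (W.starProjection e) (W.starProjection δ)
  gcongr
  linarith

end Geometry

/-! ### From good noise to the contraction set -/

/-- A parameter lies in the contraction set if the same data are explained with good noise both by
that parameter, with noise `e`, and by the true one, with noise `e'`. The number `ρ` bounds
`σ / σs`, and `η` measures the inactive coefficients. -/
theorem mem_contractionSet_of_goodNoise {n p : ℕ} {X : Matrix (Fin n) (Fin p) ℝ} {σs σ : ℝ}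
    {βs β : Fin p → ℝ} {ξ : Finset (Fin p)} {z₀ M₁ M₂ K lam ε t b η ρ : ℝ}
    (hn : 0 < n) (hcol : ∀ j, ‖WithLp.toLp 2 (Xᵀ j)‖ = Real.sqrt n)
    (hσs : 0 < σs) (hσ : 0 < σ) (hε : 0 ≤ ε) (hb : 0 ≤ b)
    (hne : (activeSet βs).Nonempty) (hfull : FullRank X (activeSet βs))
    (hlam : lam = muev X (activeSet βs) ((K + 1) * sparsity βs)) (hlam0 : 0 < lam)
    (hξ : FullRank X ξ) (hcard : ((ξ \ activeSet βs).card : ℝ) ≤ K * sparsity βs)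
    (hspike : ∀ j, j ∉ ξ → |β j| ≤ σ * z₀) (hz : p * |z₀| ≤ η * ε)
    {e e' : EuclideanSpace ℝ (Fin n)}
    (he : e ∈ goodNoise X (ξ ∪ activeSet βs) (t * ε) (b ^ 2 * (n * ε ^ 2)))
    (he' : e' ∈ goodNoise X (ξ ∪ activeSet βs) (t * ε) (b ^ 2 * (n * ε ^ 2)))
    (heq : X *ᵥ β + σ • e.ofLp = X *ᵥ βs + σs • e'.ofLp)
    (ht : t * ε ≤ 1) (hM₁ : t + b ^ 2 * ε + 4 * η + η ^ 2 * ε ≤ M₁) (hM₁ε : M₁ * ε < 1)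
    (hρ : (1 + M₁ * ε) / (1 - M₁ * ε) ≤ ρ ^ 2) (hρ0 : 0 ≤ ρ) (hM₂ : b + ρ * (b + 2 * η) ≤ M₂) :
    (σ, ξ, β) ∈ contractionSet X σs βs z₀ M₁ M₂ K lam ε := by
  classical
  set γ := ξ ∪ activeSet βs with hγ
  set W := colSpan X γ with hW
  have hn' : (0 : ℝ) < n := by exact_mod_cast hn
  have hsn : 0 < Real.sqrt n := Real.sqrt_pos.2 hn'
  have hsn2 : Real.sqrt n ^ 2 = n := Real.sq_sqrt hn'.le
  have hη : 0 ≤ η * ε := le_trans (by positivity) hz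
  have hunion : ((γ.card : ℕ) : ℝ) ≤ (K + 1) * sparsity βs := by
    have h1 : γ.card = (ξ \ activeSet βs).card + (activeSet βs).card := by
      rw [hγ, ← Finset.sdiff_union_self_eq_union,
        Finset.card_union_of_disjoint Finset.sdiff_disjoint]
    rw [h1]; push_cast
    have : ((activeSet βs).card : ℝ) = sparsity βs := rfl
    rw [this]; linarith
  -- Split the estimation error into its parts on and off the united model.
  set v : Fin p → ℝ := β - βs with hv
  set v₁ : Fin p → ℝ := fun j => if j ∈ γ then v j else 0 with hv₁
  set v₂ : Fin p → ℝ := fun j => if j ∈ γ then 0 else v j with hv₂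
  have hv12 : v = v₁ + v₂ := by
    ext j; simp only [hv₁, hv₂, Pi.add_apply]; split_ifs <;> simp
  have hv₂le : ∑ j, |v₂ j| ≤ σ * (η * ε) := by
    calc ∑ j, |v₂ j| ≤ ∑ _j : Fin p, σ * |z₀| := by
          refine Finset.sum_le_sum fun j _ => ?_
          simp only [hv₂]
          split_ifs with hj
          · simp only [abs_zero]; positivity
          · simp only [hγ, Finset.mem_union, not_or] at hj
            have h0 : βs j = 0 := by simpa [activeSet] using hj.2
            simp only [hv, Pi.sub_apply, h0, sub_zero]
            exact (hspike j hj.1).trans (mul_le_mul_of_nonneg_left (le_abs_self _) hσ.le)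
      _ = σ * (p * |z₀|) := by simp; ring
      _ ≤ _ := by gcongr
  set m : EuclideanSpace ℝ (Fin n) := WithLp.toLp 2 (X *ᵥ v₁) with hm
  set δ : EuclideanSpace ℝ (Fin n) := σ⁻¹ • WithLp.toLp 2 (X *ᵥ v₂) with hδ
  have hmW : m ∈ W := toLp_mulVec_mem_colSpan X fun j hj => by simp [hv₁, hj]
  have hδle : ‖δ‖ ≤ η * ε * Real.sqrt n := by
    rw [hδ, norm_smul, norm_inv, Real.norm_of_nonneg hσ.le, inv_mul_le_iff₀ hσ]
    refine (norm_toLp_mulVec_le X hcol v₂).trans ?_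
    calc Real.sqrt n * ∑ j, |v₂ j| ≤ Real.sqrt n * (σ * (η * ε)) := by gcongr
      _ = _ := by ring
  have hmain : m + σ • δ + σ • e = σs • e' := by
    have hX : X *ᵥ v₁ + X *ᵥ v₂ = X *ᵥ β - X *ᵥ βs := by
      rw [← Matrix.mulVec_add, ← hv12, hv, Matrix.mulVec_sub]
    rw [hδ, smul_smul, mul_inv_cancel₀ hσ.ne', one_smul, hm]
    ext i
    have h1 := congrFun heq i
    have h2 := congrFun hX i
    simp only [Pi.add_apply, Pi.sub_apply, Pi.smul_apply, smul_eq_mul] at h1 h2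
    simp only [PiLp.add_apply, PiLp.smul_apply, smul_eq_mul]
    linarith
  obtain ⟨he1, he2⟩ := he
  obtain ⟨he1', he2'⟩ := he'
  have hratio := scale_ratio_mem W hn' ht he1 he1' he2 he2' hδle hmW hσ hσs hmain
    (y := M₁ * ε) (by
      have h1 : (η * ε * Real.sqrt n) ^ 2 = η ^ 2 * ε ^ 2 * n := by rw [mul_pow, hsn2]; ring
      have h2 : 4 * (η * ε * Real.sqrt n) * Real.sqrt n = 4 * η * ε * n := by
        calc _ = 4 * η * ε * Real.sqrt n ^ 2 := by ring
          _ = _ := by rw [hsn2]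
      rw [h1, h2]
      have : 0 ≤ n * ε := by positivity
      have := mul_le_mul_of_nonneg_left hM₁ this
      linarith) hM₁ε
  refine ⟨hratio, hcard, hξ, hspike, ?_⟩
  have hR : b ^ 2 * (n * ε ^ 2) = (b * ε * Real.sqrt n) ^ 2 := by
    rw [mul_pow, hsn2]; ring
  have hR0 : 0 ≤ b * ε * Real.sqrt n := by positivity
  have hmle := norm_signal_le W (R := b * ε * Real.sqrt n)
    (abs_le_of_sq_le_sq' (he2.trans hR.le) hR0).2
    (abs_le_of_sq_le_sq' (he2'.trans hR.le) hR0).2 hδle hmW hσ hσs hmain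
  have hσρ : σ ≤ ρ * σs := by
    have h1 : σ ^ 2 ≤ (ρ * σs) ^ 2 := by
      have := hratio.2.trans hρ
      rw [div_le_iff₀ (by positivity)] at this
      rw [mul_pow]; exact this
    exact (abs_le_of_sq_le_sq' h1 (by positivity)).2
  have heig := muev_mul_norm_sq_le X hn hξ hunion (v := v₁) (fun j hj => by
    simp only [hv₁]; rw [if_neg hj])
  rw [← hlam] at heig
  have hlam1 : lam ≤ 1 := by
    rw [hlam]
    refine muev_le_one X hn hcol hfull ?_ hne
    have : ((activeSet βs).card : ℝ) = sparsity βs := rfl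
    rw [this]
    nlinarith [(Nat.cast_nonneg (sparsity βs) : (0 : ℝ) ≤ _)]
  have hsl : 0 < Real.sqrt lam := Real.sqrt_pos.2 hlam0
  have hsl1 : Real.sqrt lam ≤ 1 := Real.sqrt_le_one.2 hlam1
  have h1 : Real.sqrt n * (Real.sqrt lam * ‖(WithLp.toLp 2 v₁ : EuclideanSpace ℝ (Fin p))‖) ≤ ‖m‖ := by
    refine (abs_le_of_sq_le_sq' (le_trans (le_of_eq ?_) heig) (norm_nonneg _)).2
    rw [mul_pow, mul_pow, hsn2, Real.sq_sqrt hlam0.le]; ring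
  have h2 : Real.sqrt lam * ‖(WithLp.toLp 2 v₁ : EuclideanSpace ℝ (Fin p))‖ ≤
      ε * (σs * b + σ * (b + η)) := by
    refine le_of_mul_le_mul_left (h1.trans (hmle.trans (le_of_eq ?_))) hsn
    ring
  have h3 : ‖(WithLp.toLp 2 v₂ : EuclideanSpace ℝ (Fin p))‖ ≤ σ * (η * ε) := by
    refine le_trans ?_ hv₂le
    have hl := Finset.sum_nonneg fun j (_ : j ∈ Finset.univ) => abs_nonneg (v₂ j)
    refine (abs_le_of_sq_le_sq' ?_ hl).2
    rw [EuclideanSpace.real_norm_sq_eq]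
    simp only [← sq_abs (v₂ _)]
    exact Finset.sum_sq_le_sq_sum_of_nonneg fun j _ => abs_nonneg _
  change ‖WithLp.toLp 2 v‖ ≤ _
  rw [le_div_iff₀ hsl]
  have h4 : ‖(WithLp.toLp 2 v : EuclideanSpace ℝ (Fin p))‖ ≤
      ‖(WithLp.toLp 2 v₁ : EuclideanSpace ℝ (Fin p))‖ +
      ‖(WithLp.toLp 2 v₂ : EuclideanSpace ℝ (Fin p))‖ := by
    rw [hv12, WithLp.toLp_add]; exact norm_add_le _ _
  have h5 : Real.sqrt lam * ‖(WithLp.toLp 2 v₂ : EuclideanSpace ℝ (Fin p))‖ ≤ σ * (η * ε) :=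
    (mul_le_of_le_one_left (norm_nonneg _) hsl1).trans h3
  calc ‖(WithLp.toLp 2 v : EuclideanSpace ℝ (Fin p))‖ * Real.sqrt lam
      ≤ Real.sqrt lam * ‖(WithLp.toLp 2 v₁ : EuclideanSpace ℝ (Fin p))‖ +
        Real.sqrt lam * ‖(WithLp.toLp 2 v₂ : EuclideanSpace ℝ (Fin p))‖ := by
        rw [← mul_add, mul_comm]; gcongr
    _ ≤ ε * (σs * b + σ * (b + η)) + σ * (η * ε) := add_le_add h2 h5
    _ = ε * σs * b + σ * (ε * b + 2 * (η * ε)) := by ring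
    _ ≤ ε * σs * b + ρ * σs * (ε * b + 2 * (η * ε)) := by gcongr
    _ = (b + ρ * (b + 2 * η)) * σs * ε := by ring
    _ ≤ M₂ * σs * ε := by gcongr

/-! ### Prior probabilities -/

theorem IsDensityOn.isProbabilityMeasure {S : Set ℝ} {f : ℝ → ℝ} (h : IsDensityOn S f) :
    IsProbabilityMeasure (densityLaw S f) :=
  ⟨by rw [densityLaw, withDensity_apply _ MeasurableSet.univ, Measure.restrict_univ,
    h.lintegral_eq_one]⟩

theorem isProbabilityMeasure_standardizedLaw {p : ℕ} {h₀ : Measure ℝ} {h₁ : ℝ → ℝ}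
    (hh₀ : IsProbabilityMeasure h₀) (hh₁ : IsDensityOn Set.univ h₁) (ξ : Finset (Fin p)) :
    IsProbabilityMeasure (standardizedLaw h₀ h₁ ξ) := by
  have := hh₁.isProbabilityMeasure
  have : ∀ j : Fin p, IsProbabilityMeasure (if j ∈ ξ then densityLaw Set.univ h₁ else h₀) := by
    intro j; split_ifs <;> assumption
  unfold standardizedLaw
  infer_instance

theorem ofReal_mul_le_densityLaw {S : Set ℝ} {f : ℝ → ℝ} {a b c : ℝ} (hS : Set.Icc a b ⊆ S)
    (hc : 0 ≤ c) (hf : ∀ x ∈ Set.Icc a b, c ≤ f x) :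
    ENNReal.ofReal (c * (b - a)) ≤ densityLaw S f (Set.Icc a b) := by
  rw [densityLaw, withDensity_apply _ measurableSet_Icc, Measure.restrict_restrict measurableSet_Icc,
    Set.inter_eq_left.2 hS, ENNReal.ofReal_mul hc, ← Real.volume_Icc, ← setLIntegral_const]
  exact setLIntegral_mono' measurableSet_Icc fun x hx => ENNReal.ofReal_le_ofReal (hf x hx)

section Prior

variable {n p : ℕ} {X : Matrix (Fin n) (Fin p) ℝ} {g : ℝ → ℝ} {π : Finset (Fin p) → ℝ}
  {h₀ : Measure ℝ} {h₁ : ℝ → ℝ}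

theorem fullRank_empty (X : Matrix (Fin n) (Fin p) ℝ) : FullRank X ∅ := by
  have h := Matrix.rank_le_card_width (cols X ∅)
  simp only [Fintype.card_coe, Finset.card_empty, Nat.le_zero] at h
  simpa [FullRank] using h

open Classical in
theorem le_sum_fullRank (hπ : ∀ ξ, 0 ≤ π ξ) {ξ : Finset (Fin p)} (hξ : FullRank X ξ) :
    π ξ ≤ ∑ γ ∈ Finset.univ.filter (fun γ : Finset (Fin p) => FullRank X γ), π γ :=
  Finset.single_le_sum (fun γ _ => hπ γ) (by simp [hξ])

theorem modelWeight_nonneg (hπ : ∀ ξ, 0 ≤ π ξ) (ξ : Finset (Fin p)) : 0 ≤ modelWeight X π ξ := by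
  unfold modelWeight
  split_ifs
  · exact div_nonneg (hπ ξ) (Finset.sum_nonneg fun γ _ => hπ γ)
  · exact le_rfl

theorem modelWeight_le (hπ : ∀ ξ, 0 ≤ π ξ) (h0 : 0 < π ∅) (ξ : Finset (Fin p)) :
    modelWeight X π ξ ≤ π ξ / π ∅ := by
  unfold modelWeight
  split_ifs
  · exact div_le_div_of_nonneg_left (hπ ξ) h0 (le_sum_fullRank hπ (fullRank_empty X))
  · exact div_nonneg (hπ ξ) h0.le

/-- Normalizing over the full-rank models can only increase the probability of such a model. -/
theorem le_modelWeight (hπ : ∀ ξ, 0 ≤ π ξ) (hsum : ∑ ξ, π ξ = 1) (h0 : 0 < π ∅)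
    {ξ : Finset (Fin p)} (hξ : FullRank X ξ) : π ξ ≤ modelWeight X π ξ := by
  classical
  unfold modelWeight
  rw [if_pos hξ, le_div_iff₀ (h0.trans_le (le_sum_fullRank hπ (fullRank_empty X)))]
  refine mul_le_of_le_one_right (hπ ξ) (le_trans ?_ hsum.le)
  exact Finset.sum_le_sum_of_subset_of_nonneg (Finset.filter_subset _ _) fun γ _ _ => hπ γ

theorem sum_modelWeight (hπ : ∀ ξ, 0 ≤ π ξ) (h0 : 0 < π ∅) : ∑ ξ, modelWeight X π ξ = 1 := by
  classical
  have hpos := h0.trans_le (le_sum_fullRank (X := X) hπ (fullRank_empty X))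
  unfold modelWeight
  rw [← Finset.sum_filter, ← Finset.sum_div]
  exact div_self hpos.ne'

theorem prior_apply (X : Matrix (Fin n) (Fin p) ℝ) (g : ℝ → ℝ) (π : Finset (Fin p) → ℝ)
    (h₀ : Measure ℝ) (h₁ : ℝ → ℝ) {B : Set (Param p)} (hB : MeasurableSet B) :
    prior X g π h₀ h₁ B = ∑ ξ, ENNReal.ofReal (modelWeight X π ξ) *
      ((densityLaw (Set.Ioi 0) g).prod (standardizedLaw h₀ h₁ ξ))
        {vz | (Real.sqrt vz.1, ξ, Real.sqrt vz.1 • vz.2) ∈ B} := by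
  simp only [prior, Measure.coe_finsetSum, Finset.sum_apply, Measure.smul_apply, smul_eq_mul]
  refine Finset.sum_congr rfl fun ξ _ => ?_
  rw [Measure.map_apply (by fun_prop) hB]
  rfl

theorem prior_le_one (hg : IsDensityOn (Set.Ioi 0) g) (hh₀ : IsProbabilityMeasure h₀)
    (hh₁ : IsDensityOn Set.univ h₁) (hπ : ∀ ξ, 0 ≤ π ξ) (h0 : 0 < π ∅) (B : Set (Param p)) :
    prior X g π h₀ h₁ B ≤ 1 := by
  have := hg.isProbabilityMeasure
  have := isProbabilityMeasure_standardizedLaw (p := p) hh₀ hh₁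
  refine (measure_mono (Set.subset_univ B)).trans ?_
  rw [prior_apply _ _ _ _ _ MeasurableSet.univ]
  calc _ ≤ ∑ ξ, ENNReal.ofReal (modelWeight X π ξ) :=
        Finset.sum_le_sum fun ξ _ => mul_le_of_le_one_right (by simp) prob_le_one
    _ = 1 := by
      rw [← ENNReal.ofReal_sum_of_nonneg fun ξ _ => modelWeight_nonneg hπ ξ, sum_modelWeight hπ h0,
        ENNReal.ofReal_one]

theorem prior_model_le (hg : IsDensityOn (Set.Ioi 0) g) (hh₀ : IsProbabilityMeasure h₀)
    (hh₁ : IsDensityOn Set.univ h₁) (hπ : ∀ ξ, 0 ≤ π ξ) (h0 : 0 < π ∅)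
    (S : Finset (Finset (Fin p))) :
    prior X g π h₀ h₁ {θ | θ.2.1 ∈ S} ≤ ENNReal.ofReal ((∑ ξ ∈ S, π ξ) / π ∅) := by
  classical
  have := hg.isProbabilityMeasure
  have := isProbabilityMeasure_standardizedLaw (p := p) hh₀ hh₁
  have hm : MeasurableSet {θ : Param p | θ.2.1 ∈ S} :=
    (measurable_fst.comp measurable_snd) (MeasurableSpace.measurableSet_top (s := {ξ | ξ ∈ S}))
  rw [prior_apply _ _ _ _ _ hm, Finset.sum_div,
    ENNReal.ofReal_sum_of_nonneg fun ξ _ => div_nonneg (hπ ξ) h0.le]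
  rw [← Finset.sum_subset (Finset.subset_univ S)]
  · refine Finset.sum_le_sum fun ξ _ => ?_
    exact (mul_le_of_le_one_right (by simp) prob_le_one).trans
      (ENNReal.ofReal_le_ofReal (modelWeight_le hπ h0 ξ))
  · intro ξ _ hξ
    simp [hξ]

theorem prior_not_fullRank : prior X g π h₀ h₁ {θ | ¬ FullRank X θ.2.1} = 0 := by
  have hm : MeasurableSet {θ : Param p | ¬ FullRank X θ.2.1} :=
    (measurable_fst.comp measurable_snd)
      (MeasurableSpace.measurableSet_top (s := {ξ | ¬ FullRank X ξ}))
  rw [prior_apply _ _ _ _ _ hm]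
  refine Finset.sum_eq_zero fun ξ _ => ?_
  by_cases hξ : FullRank X ξ
  · simp [hξ]
  · simp [modelWeight, hξ]

theorem prior_scale_nonpos (hh₀ : IsProbabilityMeasure h₀)
    (hh₁ : IsDensityOn Set.univ h₁) : prior X g π h₀ h₁ {θ | ¬ 0 < θ.1} = 0 := by
  have := isProbabilityMeasure_standardizedLaw (p := p) hh₀ hh₁
  have hm : MeasurableSet {θ : Param p | ¬ 0 < θ.1} :=
    (measurableSet_lt measurable_const measurable_fst).compl
  rw [prior_apply _ _ _ _ _ hm]
  refine Finset.sum_eq_zero fun ξ _ => ?_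
  have h1 : {vz : ℝ × (Fin p → ℝ) | (Real.sqrt vz.1, ξ, Real.sqrt vz.1 • vz.2) ∈
      {θ : Param p | ¬ 0 < θ.1}} ⊆ (Set.Ioi (0 : ℝ))ᶜ ×ˢ Set.univ := by
    rintro ⟨v, z⟩ h
    simpa only [Set.mem_ofPred_eq, Real.sqrt_pos, Set.mem_prod, Set.mem_compl_iff, Set.mem_Ioi,
      Set.mem_univ, and_true] using h
  have h2 : densityLaw (Set.Ioi 0) g (Set.Ioi (0 : ℝ))ᶜ = 0 := by
    rw [densityLaw, withDensity_apply _ measurableSet_Ioi.compl,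
      Measure.restrict_restrict measurableSet_Ioi.compl, Set.compl_inter_self,
      Measure.restrict_empty, lintegral_zero_measure]
  rw [measure_mono_null h1, mul_zero]
  rw [Measure.prod_prod, h2, zero_mul]

/-- The models carry the discrete σ-algebra, so that membership in the model is measurable. -/
theorem measurableSet_spike (z₀ : ℝ) :
    MeasurableSet {θ : Param p | ∀ j, j ∉ θ.2.1 → |θ.2.2 j| ≤ θ.1 * z₀} := by
  have h : ∀ j : Fin p, MeasurableSet {θ : Param p | j ∉ θ.2.1 → |θ.2.2 j| ≤ θ.1 * z₀} := by
    intro j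
    have h1 : MeasurableSet {θ : Param p | j ∈ θ.2.1} :=
      (measurable_fst.comp measurable_snd) (MeasurableSpace.measurableSet_top (s := {ξ | j ∈ ξ}))
    have h2 : MeasurableSet {θ : Param p | |θ.2.2 j| ≤ θ.1 * z₀} :=
      measurableSet_le (by fun_prop) (by fun_prop)
    convert h1.union h2 using 1
    ext θ
    simp only [Set.mem_ofPred_eq, Set.mem_union]
    tauto
  convert MeasurableSet.iInter h using 1
  ext θ
  simp

/-- Off the model, `|β j| ≤ σ z₀` says that the standardized coefficient is at most `z₀`, so a union
bound over the coordinates applies for every model. -/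
theorem prior_spike_le (hg : IsDensityOn (Set.Ioi 0) g) (hh₀ : IsProbabilityMeasure h₀)
    (hh₁ : IsDensityOn Set.univ h₁) (hπ : ∀ ξ, 0 ≤ π ξ) (h0 : 0 < π ∅) (z₀ : ℝ) :
    prior X g π h₀ h₁ {θ | ¬ ∀ j, j ∉ θ.2.1 → |θ.2.2 j| ≤ θ.1 * z₀} ≤ p * h₀ {z | z₀ < |z|} := by
  classical
  have := hg.isProbabilityMeasure
  have := hh₁.isProbabilityMeasure
  have := isProbabilityMeasure_standardizedLaw (p := p) hh₀ hh₁
  have hfac : ∀ (ξ : Finset (Fin p)) (j : Fin p),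
      IsProbabilityMeasure (if j ∈ ξ then densityLaw Set.univ h₁ else h₀) := by
    intro ξ j; split_ifs <;> assumption
  have hm : MeasurableSet {θ : Param p | ¬ ∀ j, j ∉ θ.2.1 → |θ.2.2 j| ≤ θ.1 * z₀} := by
    exact (measurableSet_spike z₀).compl
  rw [prior_apply _ _ _ _ _ hm]
  have hcomp : ∀ ξ : Finset (Fin p), ((densityLaw (Set.Ioi 0) g).prod (standardizedLaw h₀ h₁ ξ))
      {vz | (Real.sqrt vz.1, ξ, Real.sqrt vz.1 • vz.2) ∈
        {θ : Param p | ¬ ∀ j, j ∉ θ.2.1 → |θ.2.2 j| ≤ θ.1 * z₀}} ≤ p * h₀ {z | z₀ < |z|} := by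
    intro ξ
    have h1 : {vz : ℝ × (Fin p → ℝ) | (Real.sqrt vz.1, ξ, Real.sqrt vz.1 • vz.2) ∈
        {θ : Param p | ¬ ∀ j, j ∉ θ.2.1 → |θ.2.2 j| ≤ θ.1 * z₀}} ⊆
        Set.univ ×ˢ ⋃ j ∈ ξᶜ, (fun z : Fin p → ℝ => z j) ⁻¹' {z | z₀ < |z|} := by
      rintro ⟨v, z⟩ h
      simp only [Set.mem_ofPred_eq, not_forall, Pi.smul_apply, smul_eq_mul, abs_mul, not_le,
        abs_of_nonneg (Real.sqrt_nonneg v)] at h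
      obtain ⟨j, hj, h⟩ := h
      refine ⟨trivial, Set.mem_iUnion₂.2 ⟨j, by simpa using hj, ?_⟩⟩
      exact lt_of_mul_lt_mul_left h (Real.sqrt_nonneg v)
    refine (measure_mono h1).trans ?_
    rw [Measure.prod_prod, measure_univ, one_mul]
    refine (measure_biUnion_finset_le _ _).trans ?_
    calc ∑ j ∈ ξᶜ, standardizedLaw h₀ h₁ ξ ((fun z : Fin p → ℝ => z j) ⁻¹' {z | z₀ < |z|})
        ≤ ∑ j ∈ ξᶜ, h₀ {z | z₀ < |z|} := by
          refine Finset.sum_le_sum fun j hj => le_of_eq ?_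
          have hmj : MeasurableSet {z : ℝ | z₀ < |z|} :=
            measurableSet_lt measurable_const (by fun_prop)
          unfold standardizedLaw
          have := (measurePreserving_eval
            (fun j => if j ∈ ξ then densityLaw Set.univ h₁ else h₀) j).measure_preimage
            hmj.nullMeasurableSet
          rw [if_neg (by simpa using hj)] at this
          exact this
      _ ≤ p * h₀ {z | z₀ < |z|} := by
          rw [Finset.sum_const, nsmul_eq_mul]
          gcongr
          exact (Finset.card_le_univ _).trans (by simp)
  calc _ ≤ ∑ ξ, ENNReal.ofReal (modelWeight X π ξ) * (p * h₀ {z | z₀ < |z|}) :=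
        Finset.sum_le_sum fun ξ _ => mul_le_mul_right (hcomp ξ) _
    _ = _ := by
      rw [← Finset.sum_mul, ← ENNReal.ofReal_sum_of_nonneg fun ξ _ => modelWeight_nonneg hπ ξ,
        sum_modelWeight hπ h0, ENNReal.ofReal_one, one_mul]

/-- The box of standardized coefficients with center `c` and half-width `w` on the model `ξ`, and
half-width `z₀` about the origin off the model. -/
def slabBox (ξ : Finset (Fin p)) (c : Fin p → ℝ) (w z₀ : ℝ) : Set (Fin p → ℝ) :=
  {z | ∀ j, if j ∈ ξ then z j ∈ Set.Icc (c j - w) (c j + w) else |z j| ≤ z₀}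

/-- The mass of a box inside the region where the slab density is at least `a`. The factors of the
inactive coordinates are combined by Bernoulli's inequality. -/
theorem standardizedLaw_slabBox_ge (hh₀ : IsProbabilityMeasure h₀)
    (hh₁ : IsDensityOn Set.univ h₁) {ξ : Finset (Fin p)} {c : Fin p → ℝ} {w z₀ R a q : ℝ}
    (ha : 0 ≤ a) (hw : 0 ≤ w) (hR : ∀ z, |z| ≤ R → a ≤ h₁ z) (hc : ∀ j ∈ ξ, |c j| + w ≤ R)
    (hq0 : 0 ≤ q) (hq1 : q ≤ 1) (hq : h₀.real {z | z₀ < |z|} ≤ q) :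
    ENNReal.ofReal ((a * (2 * w)) ^ ξ.card * (1 - p * q)) ≤
      standardizedLaw h₀ h₁ ξ (slabBox ξ c w z₀) := by
  classical
  have := hh₁.isProbabilityMeasure
  have hfac : ∀ j : Fin p,
      IsProbabilityMeasure (if j ∈ ξ then densityLaw Set.univ h₁ else h₀) := by
    intro j; split_ifs <;> assumption
  have hbox : slabBox ξ c w z₀ = Set.univ.pi fun j =>
      if j ∈ ξ then Set.Icc (c j - w) (c j + w) else {z | |z| ≤ z₀} := by
    ext z
    simp only [slabBox, Set.mem_ofPred_eq, Set.mem_univ_pi]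
    refine forall_congr' fun j => ?_
    split_ifs <;> rfl
  rw [hbox, standardizedLaw, Measure.pi_pi]
  have hbern : 1 - p * q ≤ (1 - q) ^ (p - ξ.card) := by
    -- Bernoulli's inequality.
    have h1 := one_add_mul_le_pow (a := -q) (by linarith) p
    calc 1 - p * q ≤ (1 - q) ^ p := by rw [sub_eq_add_neg 1 q]; linarith
      _ ≤ (1 - q) ^ (p - ξ.card) :=
        pow_le_pow_of_le_one (by linarith) (by linarith) (Nat.sub_le _ _)
  calc ENNReal.ofReal ((a * (2 * w)) ^ ξ.card * (1 - p * q))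
      ≤ ENNReal.ofReal ((a * (2 * w)) ^ ξ.card * (1 - q) ^ (p - ξ.card)) := by
        apply ENNReal.ofReal_le_ofReal; gcongr
    _ = ∏ j : Fin p, if j ∈ ξ then ENNReal.ofReal (a * (2 * w)) else ENNReal.ofReal (1 - q) := by
        rw [Finset.prod_ite, Finset.prod_const, Finset.prod_const,
          ENNReal.ofReal_mul (by positivity), ENNReal.ofReal_pow (by positivity),
          ENNReal.ofReal_pow (by linarith)]
        congr 2
        · simp
        · rw [Finset.filter_not, Finset.card_sdiff_of_subset (Finset.filter_subset _ _)]
          simp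
    _ ≤ _ := by
        refine Finset.prod_le_prod' fun j _ => ?_
        split_ifs with hj
        · refine le_trans (le_of_eq ?_) (ofReal_mul_le_densityLaw (Set.subset_univ _) ha fun x hx =>
            hR x ?_)
          · congr 1; ring
          · have := hc j hj
            rw [abs_le]
            constructor <;> linarith [hx.1, hx.2, neg_abs_le (c j), le_abs_self (c j)]
        · have hcompl : {z : ℝ | |z| ≤ z₀} = {z | z₀ < |z|}ᶜ := by ext; simp
          rw [hcompl, ← ofReal_measureReal, probReal_compl_eq_one_sub
            (measurableSet_lt measurable_const (by fun_prop))]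
          exact ENNReal.ofReal_le_ofReal (by linarith)

/-- A lower bound for an average over the prior, from a lower bound `L` of the integrand over the
parameters with model `ξ`, variance in `[v₁, v₂]` and standardized coefficients in a box, whose
center may depend on the variance. -/
theorem le_lintegral_prior (hg : IsDensityOn (Set.Ioi 0) g) (hh₀ : IsProbabilityMeasure h₀)
    (hh₁ : IsDensityOn Set.univ h₁) {F : Param p → ℝ≥0∞} (hF : Measurable F)
    {ξ : Finset (Fin p)} {c : ℝ → Fin p → ℝ} (hc : Measurable c) {w z₀ v₁ v₂ : ℝ} {L A B : ℝ≥0∞}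
    (hL : ∀ v ∈ Set.Icc v₁ v₂, ∀ z ∈ slabBox ξ (c v) w z₀,
      L ≤ F (Real.sqrt v, ξ, Real.sqrt v • z))
    (hA : A ≤ densityLaw (Set.Ioi 0) g (Set.Icc v₁ v₂))
    (hB : ∀ v ∈ Set.Icc v₁ v₂, B ≤ standardizedLaw h₀ h₁ ξ (slabBox ξ (c v) w z₀)) :
    ENNReal.ofReal (modelWeight X π ξ) * (L * (A * B)) ≤ ∫⁻ θ, F θ ∂(prior X g π h₀ h₁) := by
  classical
  have := hg.isProbabilityMeasure
  have := isProbabilityMeasure_standardizedLaw (p := p) hh₀ hh₁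
  rw [prior, lintegral_finsetSum_measure]
  refine le_trans ?_ (Finset.single_le_sum (fun _ _ => zero_le) (Finset.mem_univ ξ))
  rw [lintegral_smul_measure, smul_eq_mul, lintegral_map hF (by fun_prop)]
  gcongr
  set S : Set (ℝ × (Fin p → ℝ)) := {vz | vz.1 ∈ Set.Icc v₁ v₂ ∧ vz.2 ∈ slabBox ξ (c vz.1) w z₀}
    with hS
  have hSm : MeasurableSet S := by
    have h : ∀ j : Fin p, MeasurableSet {vz : ℝ × (Fin p → ℝ) |
        if j ∈ ξ then vz.2 j ∈ Set.Icc (c vz.1 j - w) (c vz.1 j + w) else |vz.2 j| ≤ z₀} := by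
      intro j
      have hcj : Measurable fun vz : ℝ × (Fin p → ℝ) => c vz.1 j :=
        (measurable_pi_apply j).comp (hc.comp measurable_fst)
      split_ifs
      · have hzj : Measurable fun vz : ℝ × (Fin p → ℝ) => vz.2 j := by fun_prop
        exact MeasurableSet.inter (measurableSet_le (hcj.sub_const w) hzj)
          (measurableSet_le hzj (hcj.add_const w))
      · exact measurableSet_le (by fun_prop) (by fun_prop)
    have heq : {vz : ℝ × (Fin p → ℝ) | vz.2 ∈ slabBox ξ (c vz.1) w z₀} =
        ⋂ j, {vz : ℝ × (Fin p → ℝ) |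
          if j ∈ ξ then vz.2 j ∈ Set.Icc (c vz.1 j - w) (c vz.1 j + w) else |vz.2 j| ≤ z₀} := by
      ext vz
      simp only [slabBox, Set.mem_iInter, Set.mem_ofPred_eq]
    have hbox : MeasurableSet {vz : ℝ × (Fin p → ℝ) | vz.2 ∈ slabBox ξ (c vz.1) w z₀} := by
      rw [heq]; exact MeasurableSet.iInter h
    exact (measurable_fst measurableSet_Icc).inter hbox
  calc L * (A * B) ≤ L * ((densityLaw (Set.Ioi 0) g).prod (standardizedLaw h₀ h₁ ξ)) S := by
        gcongr
        rw [Measure.prod_apply hSm]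
        calc A * B ≤ densityLaw (Set.Ioi 0) g (Set.Icc v₁ v₂) * B := by gcongr
          _ = ∫⁻ _v in Set.Icc v₁ v₂, B ∂(densityLaw (Set.Ioi 0) g) := by
            rw [setLIntegral_const, mul_comm]
          _ ≤ ∫⁻ v in Set.Icc v₁ v₂, standardizedLaw h₀ h₁ ξ (Prod.mk v ⁻¹' S)
                ∂(densityLaw (Set.Ioi 0) g) := by
            refine setLIntegral_mono' measurableSet_Icc fun v hv => (hB v hv).trans ?_
            exact measure_mono fun z hz => ⟨hv, hz⟩
          _ ≤ _ := setLIntegral_le_lintegral _ _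
    _ = ∫⁻ _vz in S, L ∂((densityLaw (Set.Ioi 0) g).prod (standardizedLaw h₀ h₁ ξ)) :=
        (setLIntegral_const _ _).symm
    _ ≤ ∫⁻ vz in S, F (Real.sqrt vz.1, ξ, Real.sqrt vz.1 • vz.2)
          ∂((densityLaw (Set.Ioi 0) g).prod (standardizedLaw h₀ h₁ ξ)) :=
        setLIntegral_mono' hSm fun vz hvz => hL _ hvz.1 _ hvz.2
    _ ≤ _ := setLIntegral_le_lintegral _ _

end Prior

/-! ### A lower bound for the evidence -/

section Evidence

variable {n p : ℕ} {X : Matrix (Fin n) (Fin p) ℝ}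

/-- Good noise has no large inner product with a column of the model, since only its projection
matters. -/
theorem abs_inner_col_le_of_goodNoise (hcol : ∀ j, ‖WithLp.toLp 2 (Xᵀ j)‖ = Real.sqrt n)
    {γ : Finset (Fin p)} {x h : ℝ} (hh : 0 ≤ h) {e : EuclideanSpace ℝ (Fin n)}
    (he : e ∈ goodNoise X γ x (n * h ^ 2)) {j : Fin p} (hj : j ∈ γ) :
    |inner ℝ e (WithLp.toLp 2 (Xᵀ j))| ≤ n * h := by
  have hsn2 : Real.sqrt n ^ 2 = n := Real.sq_sqrt (Nat.cast_nonneg n)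
  set c : EuclideanSpace ℝ (Fin n) := WithLp.toLp 2 (Xᵀ j) with hc
  have hcW : c ∈ colSpan X γ := Submodule.subset_span ⟨j, hj, rfl⟩
  have h1 : inner ℝ e c = inner ℝ ((colSpan X γ).starProjection e) c := by
    conv_lhs => rw [← Submodule.starProjection_eq_self_iff.2 hcW]
    rw [Submodule.inner_starProjection_left_eq_right]
  have h2 : ‖(colSpan X γ).starProjection e‖ ≤ Real.sqrt n * h := by
    refine (abs_le_of_sq_le_sq' (he.2.trans (le_of_eq ?_)) (by positivity)).2
    rw [mul_pow, hsn2]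
  rw [h1]
  calc _ ≤ ‖(colSpan X γ).starProjection e‖ * ‖c‖ := abs_real_inner_le_norm _ _
    _ ≤ Real.sqrt n * h * Real.sqrt n := by rw [hc, hcol]; gcongr
    _ = Real.sqrt n ^ 2 * h := by ring
    _ = n * h := by rw [hsn2]

/-- The likelihood ratio of a parameter close to the true one: the noise level may be larger by a
relative amount `y`, and the coefficients may be off by `σ y` in total. -/
theorem likelihood_ratio_ge (hcol : ∀ j, ‖WithLp.toLp 2 (Xᵀ j)‖ = Real.sqrt n)
    {σ σs y τ h : ℝ} {βs β : Fin p → ℝ} (ξ ξs : Finset (Fin p)) {e : EuclideanSpace ℝ (Fin n)}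
    {Y : Fin n → ℝ} (hY : Y = X *ᵥ βs + σs • e.ofLp)
    (hσs : 0 < σs) (hσ : σs ≤ σ) (hσy : σ ^ 2 ≤ σs ^ 2 * (1 + y))
    (hτ1 : τ ≤ 1) (hτ0 : 0 ≤ τ) (he : n * (1 - τ) ≤ ‖e‖ ^ 2) (hh : 0 ≤ h)
    (hinner : ∀ j, |inner ℝ e (WithLp.toLp 2 (Xᵀ j))| ≤ n * h)
    (hsum : ∑ j, |β j - βs j| ≤ σ * y) :
    ENNReal.ofReal (Real.exp (-(n * (y ^ 2 + τ * y + h * y)))) * likelihood X Y (σs, ξs, βs) ≤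
      likelihood X Y (σ, ξ, β) := by
  have hσ0 : 0 < σ := hσs.trans_le hσ
  have hsn2 : Real.sqrt n ^ 2 = n := Real.sq_sqrt (Nat.cast_nonneg n)
  have hy0 : 0 ≤ y := by
    have := (Finset.sum_nonneg fun j _ => abs_nonneg _).trans hsum
    exact (mul_nonneg_iff_of_pos_left hσ0).1 this
  rw [likelihood_eq X Y (show 0 < ((σs, ξs, βs) : Param p).1 from hσs),
    likelihood_eq X Y (show 0 < ((σ, ξ, β) : Param p).1 from hσ0),
    ← ENNReal.ofReal_mul (Real.exp_pos _).le]
  apply ENNReal.ofReal_le_ofReal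
  simp only
  set b : Fin p → ℝ := β - βs with hb
  set u : EuclideanSpace ℝ (Fin n) := WithLp.toLp 2 (X *ᵥ b) with hu
  have hres₀ : ‖WithLp.toLp 2 (Y - X *ᵥ βs)‖ ^ 2 = σs ^ 2 * ‖e‖ ^ 2 := by
    have : WithLp.toLp 2 (Y - X *ᵥ βs) = σs • e := by
      rw [hY]; ext i; simp
    rw [this, norm_smul, mul_pow, Real.norm_of_nonneg hσs.le]
  have hres : ‖WithLp.toLp 2 (Y - X *ᵥ β)‖ ^ 2 =
      σs ^ 2 * ‖e‖ ^ 2 - 2 * σs * inner ℝ e u + ‖u‖ ^ 2 := by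
    have : WithLp.toLp 2 (Y - X *ᵥ β) = σs • e - u := by
      rw [hY, hu, hb, Matrix.mulVec_sub]; ext i; simp; ring
    rw [this, norm_sub_sq_real, norm_smul, mul_pow, Real.norm_of_nonneg hσs.le,
      real_inner_smul_left]
    ring
  have hu_norm : ‖u‖ ^ 2 ≤ n * (σ * y) ^ 2 := by
    have h1 : ‖u‖ ≤ Real.sqrt n * (σ * y) :=
      (norm_toLp_mulVec_le X hcol b).trans (by gcongr; exact hsum)
    calc ‖u‖ ^ 2 ≤ (Real.sqrt n * (σ * y)) ^ 2 := by gcongr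
      _ = _ := by rw [mul_pow, hsn2]
  have hu_inner : -(n * h * (σ * y)) ≤ inner ℝ e u := by
    have h1 : |inner ℝ e u| ≤ n * h * (σ * y) := by
      rw [hu, toLp_mulVec_eq_sum, inner_sum]
      calc _ ≤ ∑ j, |inner ℝ e (b j • (WithLp.toLp 2 (Xᵀ j) : EuclideanSpace ℝ (Fin n)))| :=
            Finset.abs_sum_le_sum_abs _ _
        _ ≤ ∑ j, (n * h) * |b j| := by
            refine Finset.sum_le_sum fun j _ => ?_
            rw [real_inner_smul_right, abs_mul, mul_comm]
            gcongr
            exact hinner j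
        _ = n * h * ∑ j, |b j| := by rw [Finset.mul_sum]
        _ ≤ _ := by gcongr; exact hsum
    exact (abs_le.1 h1).1
  rw [hres₀, hres]
  set x : ℝ := σ ^ 2 / σs ^ 2 - 1 with hx
  have hσx : σ ^ 2 = σs ^ 2 * (1 + x) := by rw [hx]; field_simp; ring
  have hx0 : 0 ≤ x := by
    have h1 : σs ^ 2 ≤ σ ^ 2 := by gcongr
    rw [hx, sub_nonneg, le_div_iff₀ (by positivity)]; linarith
  have hxy : x ≤ y := by
    rw [hσx] at hσy
    have := le_of_mul_le_mul_left hσy (by positivity)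
    linarith
  -- The normalizing constants.
  have hnorm : (Real.sqrt (2 * Real.pi) * σs)⁻¹ ^ n * Real.exp (-(n * (x / 2))) ≤
      (Real.sqrt (2 * Real.pi) * σ)⁻¹ ^ n := by
    have h1 : σ ≤ σs * Real.exp (x / 2) := by
      refine (abs_le_of_sq_le_sq' ?_ (by positivity)).2
      rw [mul_pow, hσx, ← Real.exp_nat_mul]
      gcongr
      have := Real.add_one_le_exp x
      push_cast
      rw [mul_div_cancel₀ _ two_ne_zero]
      linarith
    have h2 : (Real.sqrt (2 * Real.pi) * σs)⁻¹ * Real.exp (-(x / 2)) ≤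
        (Real.sqrt (2 * Real.pi) * σ)⁻¹ := by
      rw [Real.exp_neg, ← mul_inv]
      apply inv_anti₀ (by positivity)
      rw [mul_assoc]
      gcongr
    calc _ = ((Real.sqrt (2 * Real.pi) * σs)⁻¹ * Real.exp (-(x / 2))) ^ n := by
          rw [mul_pow, ← Real.exp_nat_mul]; ring_nf
      _ ≤ _ := by gcongr
  have hexp : -(n * (y ^ 2 + τ * y + h * y)) + -(σs ^ 2 * ‖e‖ ^ 2 / (2 * σs ^ 2)) ≤
      -(n * (x / 2)) +
        -((σs ^ 2 * ‖e‖ ^ 2 - 2 * σs * inner ℝ e u + ‖u‖ ^ 2) / (2 * σ ^ 2)) := by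
    have hn0 : (0 : ℝ) ≤ n := Nat.cast_nonneg n
    have e1 : σs ^ 2 * ‖e‖ ^ 2 / (2 * σs ^ 2) = ‖e‖ ^ 2 / 2 := by field_simp
    have e2 : (σs ^ 2 * ‖e‖ ^ 2 - 2 * σs * inner ℝ e u + ‖u‖ ^ 2) / (2 * σ ^ 2) =
        ‖e‖ ^ 2 / 2 * (1 / (1 + x)) - σs * inner ℝ e u / σ ^ 2 + ‖u‖ ^ 2 / (2 * σ ^ 2) := by
      have h3 : 1 / (1 + x) = σs ^ 2 / σ ^ 2 := by rw [hσx]; field_simp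
      rw [h3]; field_simp
    have b1 : n * (1 - τ) / 2 * (x - x ^ 2) ≤ ‖e‖ ^ 2 / 2 * (1 - 1 / (1 + x)) := by
      have h3 : x - x ^ 2 ≤ 1 - 1 / (1 + x) := by
        have : 1 - 1 / (1 + x) = x / (1 + x) := by field_simp; ring
        rw [this, le_div_iff₀ (by linarith)]
        nlinarith [pow_nonneg hx0 3]
      have h4 : 0 ≤ 1 - 1 / (1 + x) := by
        rw [sub_nonneg, div_le_one (by linarith)]; linarith
      have h5 : 0 ≤ n * (1 - τ) / 2 := by
        have : 0 ≤ 1 - τ := by linarith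
        positivity
      calc _ ≤ n * (1 - τ) / 2 * (1 - 1 / (1 + x)) := by gcongr
        _ ≤ _ := by gcongr
    have b2 : -(n * h * y) ≤ σs * inner ℝ e u / σ ^ 2 := by
      rw [le_div_iff₀ (by positivity)]
      calc -(n * h * y) * σ ^ 2 = σ * -(n * h * (σ * y)) := by ring
        _ ≤ σs * -(n * h * (σ * y)) := by
            have : 0 ≤ n * h * (σ * y) := by positivity
            nlinarith
        _ ≤ _ := by gcongr
    have b3 : ‖u‖ ^ 2 / (2 * σ ^ 2) ≤ n * y ^ 2 / 2 := by
      rw [div_le_iff₀ (by positivity)]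
      refine hu_norm.trans (le_of_eq ?_)
      ring
    have b4 : n * (1 - τ) / 2 * (x - x ^ 2) ≥ n * (x / 2) - n * y ^ 2 / 2 - n * (τ * y) := by
      have h6 : x ^ 2 ≤ y ^ 2 := by gcongr
      have h7 : τ * x ≤ τ * y := by gcongr
      have h8 : 0 ≤ τ * x ^ 2 := by positivity
      have h9 : 0 ≤ τ * y := by positivity
      have : n * ((1 - τ) / 2 * (x - x ^ 2)) ≥ n * (x / 2 - y ^ 2 / 2 - τ * y) := by
        gcongr
        linarith
      linarith
    rw [e1, e2]
    linarith
  calc _ = (Real.sqrt (2 * Real.pi) * σs)⁻¹ ^ n *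
        Real.exp (-(n * (y ^ 2 + τ * y + h * y)) + -(σs ^ 2 * ‖e‖ ^ 2 / (2 * σs ^ 2))) := by
        rw [Real.exp_add]; ring
    _ ≤ (Real.sqrt (2 * Real.pi) * σs)⁻¹ ^ n * Real.exp (-(n * (x / 2)) +
        -((σs ^ 2 * ‖e‖ ^ 2 - 2 * σs * inner ℝ e u + ‖u‖ ^ 2) / (2 * σ ^ 2))) := by gcongr
    _ = (Real.sqrt (2 * Real.pi) * σs)⁻¹ ^ n * Real.exp (-(n * (x / 2))) *
        Real.exp (-((σs ^ 2 * ‖e‖ ^ 2 - 2 * σs * inner ℝ e u + ‖u‖ ^ 2) / (2 * σ ^ 2))) := by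
        rw [Real.exp_add]; ring
    _ ≤ _ := by gcongr

/-- On the box about `βs / σ`, the coefficients `σ z` differ from `βs` by at most `σ y` in `ℓ¹` norm,
half of it from the active coordinates and half from the inactive ones. -/
theorem sum_abs_sub_le_of_mem_slabBox {σ y z₀ : ℝ} {βs z : Fin p → ℝ} (hσ : 0 < σ)
    (hs : 0 < sparsity βs) (hz₀ : p * |z₀| ≤ y / 2)
    (hz : z ∈ slabBox (activeSet βs) (fun j => βs j / σ) (y / (2 * sparsity βs)) z₀) :
    ∑ j, |(σ • z) j - βs j| ≤ σ * y := by
  classical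
  have hs' : (0 : ℝ) < sparsity βs := by exact_mod_cast hs
  have hterm : ∀ j, |(σ • z) j - βs j| ≤
      σ * ((if j ∈ activeSet βs then y / (2 * sparsity βs) else 0) + |z₀|) := by
    intro j
    have hj := hz j
    simp only [Pi.smul_apply, smul_eq_mul]
    split_ifs at hj ⊢ with hjs
    · have h1 : σ * z j - βs j = σ * (z j - βs j / σ) := by field_simp
      rw [h1, abs_mul, abs_of_pos hσ]
      gcongr
      have : |z j - βs j / σ| ≤ y / (2 * sparsity βs) := by
        rw [abs_le]; constructor <;> linarith [hj.1, hj.2]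
      linarith [abs_nonneg z₀]
    · have h0 : βs j = 0 := by simpa [activeSet] using hjs
      rw [h0, sub_zero, abs_mul, abs_of_pos hσ, zero_add]
      exact mul_le_mul_of_nonneg_left (hj.trans (le_abs_self _)) hσ.le
  calc _ ≤ ∑ j, σ * ((if j ∈ activeSet βs then y / (2 * sparsity βs) else 0) + |z₀|) :=
        Finset.sum_le_sum fun j _ => hterm j
    _ = σ * (sparsity βs * (y / (2 * sparsity βs)) + p * |z₀|) := by
        rw [← Finset.mul_sum, Finset.sum_add_distrib, Finset.sum_ite_mem, Finset.univ_inter,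
          Finset.sum_const, Finset.sum_const, Finset.card_univ, Fintype.card_fin, nsmul_eq_mul,
          nsmul_eq_mul, sparsity]
    _ ≤ σ * y := by
        gcongr
        have : sparsity βs * (y / (2 * (sparsity βs : ℝ))) = y / 2 := by field_simp
        linarith

/-- The evidence is bounded below through the prior mass of a neighbourhood of the truth. The
variance ranges over `[σs², σs² (1 + y)]`, above the true one, so that the standardized true
coefficients `βs / σ` do not leave the region where the slab density is bounded below. -/
theorem evidence_ge {g : ℝ → ℝ} {π : Finset (Fin p) → ℝ} {h₀ : Measure ℝ} {h₁ : ℝ → ℝ}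
    (hg : IsDensityOn (Set.Ioi 0) g) (hh₀ : IsProbabilityMeasure h₀)
    (hh₁ : IsDensityOn Set.univ h₁)
    (hcol : ∀ j, ‖WithLp.toLp 2 (Xᵀ j)‖ = Real.sqrt n)
    {σs y τ h z₀ a c q R : ℝ} {βs : Fin p → ℝ} {e : EuclideanSpace ℝ (Fin n)}
    {Y : Fin n → ℝ} (hY : Y = X *ᵥ βs + σs • e.ofLp)
    (hσs : 0 < σs) (hτ1 : τ ≤ 1) (hτ0 : 0 ≤ τ) (he : n * (1 - τ) ≤ ‖e‖ ^ 2) (hh : 0 ≤ h)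
    (hinner : ∀ j, |inner ℝ e (WithLp.toLp 2 (Xᵀ j))| ≤ n * h)
    (hy0 : 0 ≤ y) (hs : 0 < sparsity βs) (hz : p * |z₀| ≤ y / 2)
    (hc0 : 0 ≤ c) (hc : ∀ v ∈ Set.Icc (σs ^ 2) (σs ^ 2 * (1 + y)), c ≤ g v)
    (ha : 0 ≤ a) (hR : ∀ z, |z| ≤ R → a ≤ h₁ z)
    (hβR : ∀ j ∈ activeSet βs, |βs j / σs| + y ≤ R)
    (hq0 : 0 ≤ q) (hq1 : q ≤ 1) (hq : h₀.real {z | z₀ < |z|} ≤ q) :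
    ENNReal.ofReal (modelWeight X π (activeSet βs)) *
      (ENNReal.ofReal (Real.exp (-(n * (y ^ 2 + τ * y + h * y)))) *
          likelihood X Y (σs, activeSet βs, βs) *
        (ENNReal.ofReal (c * (σs ^ 2 * y)) *
          ENNReal.ofReal ((a * (y / sparsity βs)) ^ sparsity βs * (1 - p * q)))) ≤
      ∫⁻ θ, likelihood X Y θ ∂(prior X g π h₀ h₁) := by
  have hs' : (0 : ℝ) < sparsity βs := by exact_mod_cast hs
  have hsqrt : ∀ v ∈ Set.Icc (σs ^ 2) (σs ^ 2 * (1 + y)), σs ≤ Real.sqrt v ∧ Real.sqrt v ^ 2 = v := by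
    intro v hv
    have hv0 : 0 ≤ v := le_trans (by positivity) hv.1
    exact ⟨Real.le_sqrt_of_sq_le hv.1, Real.sq_sqrt hv0⟩
  refine le_lintegral_prior hg hh₀ hh₁ (measurable_likelihood_right X Y) (c := fun v j => βs j / Real.sqrt v)
    (measurable_pi_iff.2 fun j => by fun_prop) (w := y / (2 * sparsity βs)) (z₀ := z₀)
    (v₁ := σs ^ 2) (v₂ := σs ^ 2 * (1 + y)) ?_ ?_ ?_
  · intro v hv z hz'
    obtain ⟨hv1, hv2⟩ := hsqrt v hv
    have hv0 : 0 < Real.sqrt v := hσs.trans_le hv1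
    refine likelihood_ratio_ge hcol _ _ hY hσs hv1 (by rw [hv2]; exact hv.2) hτ1 hτ0 he hh
      hinner (sum_abs_sub_le_of_mem_slabBox hv0 hs hz hz')
  · refine le_trans (le_of_eq ?_) (ofReal_mul_le_densityLaw (f := g) (S := Set.Ioi 0)
      (a := σs ^ 2) (b := σs ^ 2 * (1 + y)) (fun v hv => ?_) hc0 hc)
    · congr 1; ring
    · exact lt_of_lt_of_le (by positivity) hv.1
  · intro v hv
    obtain ⟨hv1, -⟩ := hsqrt v hv
    have hv0 : 0 < Real.sqrt v := hσs.trans_le hv1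
    refine le_trans (le_of_eq ?_) (standardizedLaw_slabBox_ge hh₀ hh₁ ha (by positivity) hR ?_
      hq0 hq1 hq)
    · have : 2 * (y / (2 * (sparsity βs : ℝ))) = y / sparsity βs := by field_simp
      rw [this]
      rfl
    · intro j hj
      have h1 : |βs j / Real.sqrt v| ≤ |βs j / σs| := by
        rw [abs_div, abs_div, abs_of_pos hv0, abs_of_pos hσs]
        gcongr
      have h2 : y / (2 * sparsity βs) ≤ y := by
        have : (1 : ℝ) ≤ sparsity βs := by exact_mod_cast hs
        exact div_le_self hy0 (by linarith)
      linarith [hβR j hj]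

end Evidence

/-! ### Posterior probabilities -/

section Posterior

variable {n p : ℕ} {X : Matrix (Fin n) (Fin p) ℝ}

/-- A union bound over the `∑ k ≤ m, p.choose k ≤ (m + 1) p ^ m` models of size at most `m`. -/
theorem stdGaussian_exists_not_good_le {m : ℕ} {ξs : Finset (Fin p)} {x r q : ℝ} (hp : 0 < p)
    (hq0 : 0 ≤ q)
    (hq : ∀ ζ : Finset (Fin p), ζ.card ≤ m →
      stdGaussian (EuclideanSpace ℝ (Fin n)) (goodNoise X (ζ ∪ ξs) x r)ᶜ ≤ ENNReal.ofReal q) :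
    stdGaussian (EuclideanSpace ℝ (Fin n))
      {e | ¬ ∀ ζ : Finset (Fin p), ζ.card ≤ m → e ∈ goodNoise X (ζ ∪ ξs) x r} ≤
      ENNReal.ofReal ((m + 1) * (p : ℝ) ^ m * q) := by
  classical
  set S : Finset (Finset (Fin p)) := Finset.univ.filter fun ζ => ζ.card ≤ m with hS
  have hcard : (S.card : ℝ) ≤ (m + 1) * (p : ℝ) ^ m := by
    have h1 : S ⊆ (Finset.range (m + 1)).biUnion fun k => Finset.powersetCard k Finset.univ := by
      intro ζ hζ
      simp only [hS, Finset.mem_filter, Finset.mem_univ, true_and] at hζ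
      simp only [Finset.mem_biUnion, Finset.mem_range, Finset.mem_powersetCard]
      exact ⟨ζ.card, by omega, Finset.subset_univ _, rfl⟩
    have h2 : S.card ≤ (m + 1) * p ^ m := by
      refine (Finset.card_le_card h1).trans (Finset.card_biUnion_le.trans ?_)
      calc _ ≤ ∑ _k ∈ Finset.range (m + 1), p ^ m := by
            refine Finset.sum_le_sum fun k hk => ?_
            rw [Finset.card_powersetCard, Finset.card_univ, Fintype.card_fin]
            exact (Nat.choose_le_pow p k).trans
              (Nat.pow_le_pow_right hp (by simpa [Nat.lt_succ_iff] using hk))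
        _ = _ := by simp
    exact_mod_cast h2
  have hsub : {e : EuclideanSpace ℝ (Fin n) |
      ¬ ∀ ζ : Finset (Fin p), ζ.card ≤ m → e ∈ goodNoise X (ζ ∪ ξs) x r} ⊆
      ⋃ ζ ∈ S, (goodNoise X (ζ ∪ ξs) x r)ᶜ := by
    intro e he
    simp only [Set.mem_ofPred_eq, not_forall] at he
    obtain ⟨ζ, hζ, he⟩ := he
    exact Set.mem_iUnion₂.2 ⟨ζ, by simpa [hS] using hζ, he⟩
  refine (measure_mono hsub).trans ((measure_biUnion_finset_le _ _).trans ?_)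
  calc _ ≤ ∑ _ζ ∈ S, ENNReal.ofReal q :=
        Finset.sum_le_sum fun ζ hζ => hq ζ (by simpa [hS] using hζ)
    _ = ENNReal.ofReal (S.card * q) := by
        rw [Finset.sum_const, nsmul_eq_mul, ENNReal.ofReal_mul (by positivity),
          ENNReal.ofReal_natCast]
    _ ≤ _ := ENNReal.ofReal_le_ofReal (by gcongr)

/-- The posterior probability of a set `C` is close to `1` with high probability, if each parameter
outside `C` is excluded by the size of the model, by the size of the inactive coefficients, or
because it explains the data with good noise only when the truth does not. -/
theorem dataLaw_posterior_lt_le {g : ℝ → ℝ} {π : Finset (Fin p) → ℝ} {h₀ : Measure ℝ} {h₁ : ℝ → ℝ}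
    (hg : IsDensityOn (Set.Ioi 0) g) (hh₀ : IsProbabilityMeasure h₀)
    (hh₁ : IsDensityOn Set.univ h₁) (hπ : ∀ ξ, 0 ≤ π ξ) (h0 : 0 < π ∅) (hp : 0 < p)
    {σs z₀ x r q k a₁ a₂ κ δ : ℝ} {βs : Fin p → ℝ} {ξs : Finset (Fin p)} {C : Set (Param p)}
    (hσs : 0 < σs) (hk : 0 ≤ k) (hq0 : 0 ≤ q) (ha₁ : 0 ≤ a₁) (ha₂ : 0 ≤ a₂)
    (hκ : 0 < κ) (hδ : 0 < δ)
    (hq : ∀ ζ : Finset (Fin p), (ζ.card : ℝ) ≤ k →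
      stdGaussian (EuclideanSpace ℝ (Fin n)) (goodNoise X (ζ ∪ ξs) x r)ᶜ ≤ ENNReal.ofReal q)
    (hC : ∀ (σ : ℝ) (ξ : Finset (Fin p)) (β : Fin p → ℝ) (e e' : EuclideanSpace ℝ (Fin n)),
      0 < σ → ((ξ \ ξs).card : ℝ) ≤ k → FullRank X ξ → (∀ j, j ∉ ξ → |β j| ≤ σ * z₀) →
      e ∈ goodNoise X (ξ ∪ ξs) x r → e' ∈ goodNoise X (ξ ∪ ξs) x r →
      X *ᵥ β + σ • e.ofLp = X *ᵥ βs + σs • e'.ofLp → (σ, ξ, β) ∈ C)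
    (hsize : prior X g π h₀ h₁ {θ | ¬ ((θ.2.1 \ ξs).card : ℝ) ≤ k} ≤ ENNReal.ofReal a₁)
    (hspike : prior X g π h₀ h₁ {θ | ¬ ∀ j, j ∉ θ.2.1 → |θ.2.2 j| ≤ θ.1 * z₀} ≤ ENNReal.ofReal a₂)
    (hev : ∀ (e : EuclideanSpace ℝ (Fin n)) (Y : Fin n → ℝ), Y = X *ᵥ βs + σs • e.ofLp →
      (∀ ζ : Finset (Fin p), (ζ.card : ℝ) ≤ k → e ∈ goodNoise X (ζ ∪ ξs) x r) →
      ENNReal.ofReal κ * likelihood X Y (σs, ξs, βs) ≤ ∫⁻ θ, likelihood X Y θ ∂(prior X g π h₀ h₁)) :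
    dataLaw X σs βs {Y | ¬ 1 - δ ≤ (posteriorLaw X g π h₀ h₁ Y).real C} ≤
      ENNReal.ofReal ((k + 1) * (p : ℝ) ^ k * q + (a₁ + a₂ + q) / (δ * κ)) := by
  classical
  have := hg.isProbabilityMeasure
  set Q := prior X g π h₀ h₁ with hQdef
  have hQle : ∀ B, Q B ≤ 1 := prior_le_one hg hh₀ hh₁ hπ h0
  have hQfin : IsFiniteMeasure Q := ⟨(hQle _).trans_lt ENNReal.one_lt_top⟩
  have hlik := measurable_likelihood X
  -- The noise that the true parameter attributes to the data.
  set N : (Fin n → ℝ) → EuclideanSpace ℝ (Fin n) := fun Y => WithLp.toLp 2 (σs⁻¹ • (Y - X *ᵥ βs))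
    with hN
  have hNm : Measurable N := by fun_prop
  have hNY : ∀ Y, Y = X *ᵥ βs + σs • (N Y).ofLp := by
    intro Y
    simp only [hN, smul_smul, mul_inv_cancel₀ hσs.ne', one_smul]
    abel
  set T : Set (Fin n → ℝ) :=
    {Y | ∀ ζ : Finset (Fin p), ζ.card ≤ ⌊k⌋₊ → N Y ∈ goodNoise X (ζ ∪ ξs) x r} with hT
  have hTm : MeasurableSet T := by
    have : T = ⋂ ζ : Finset (Fin p), ⋂ (_ : ζ.card ≤ ⌊k⌋₊), N ⁻¹' goodNoise X (ζ ∪ ξs) x r := by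
      ext Y; simp [hT]
    rw [this]
    exact MeasurableSet.iInter fun ζ => MeasurableSet.iInter fun _ =>
      hNm (measurableSet_goodNoise X _ x r)
  have hfloor : ∀ j : ℕ, j ≤ ⌊k⌋₊ ↔ (j : ℝ) ≤ k := fun j => Nat.le_floor_iff hk
  -- The probability of atypical noise under the true parameter.
  have hTc : dataLaw X σs βs Tᶜ ≤ ENNReal.ofReal ((k + 1) * (p : ℝ) ^ k * q) := by
    rw [dataLaw_apply X hTm.compl]
    have hsub : {e : EuclideanSpace ℝ (Fin n) | X *ᵥ βs + σs • e.ofLp ∈ Tᶜ} ⊆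
        {e | ¬ ∀ ζ : Finset (Fin p), ζ.card ≤ ⌊k⌋₊ → e ∈ goodNoise X (ζ ∪ ξs) x r} := by
      intro e he hgood
      refine he fun ζ hζ => ?_
      have : N (X *ᵥ βs + σs • e.ofLp) = e := by
        simp only [hN, add_sub_cancel_left, smul_smul, inv_mul_cancel₀ hσs.ne', one_smul]
      rw [this]
      exact hgood ζ hζ
    refine (measure_mono hsub).trans ((stdGaussian_exists_not_good_le hp hq0 fun ζ hζ =>
      hq ζ ((hfloor _).1 hζ)).trans (ENNReal.ofReal_le_ofReal ?_))
    have h1 : ((⌊k⌋₊ : ℕ) : ℝ) ≤ k := Nat.floor_le hk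
    have h2 : (p : ℝ) ^ ⌊k⌋₊ ≤ (p : ℝ) ^ k := by
      rw [← Real.rpow_natCast]
      exact Real.rpow_le_rpow_of_exponent_le (by exact_mod_cast hp) h1
    gcongr
  -- The average probability of typical noise under the parameters outside `C`.
  have hF : ∀ θ : Param p, 0 < θ.1 → ∫⁻ Y in T, likelihood X Y θ = dataLaw X θ.1 θ.2.2 T := by
    rintro ⟨σ, ξ, β⟩ hσ
    rw [dataLaw_eq_withDensity X hσ ξ β, withDensity_apply _ hTm]
  have hFm : Measurable fun θ : Param p => ∫⁻ Y in T, likelihood X Y θ :=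
    hlik.lintegral_prod_left'
  have hms : MeasurableSet {θ : Param p | ¬ ((θ.2.1 \ ξs).card : ℝ) ≤ k} :=
    (measurable_fst.comp measurable_snd)
      (MeasurableSpace.measurableSet_top (s := {ξ | ¬ ((ξ \ ξs).card : ℝ) ≤ k}))
  have hmf : MeasurableSet {θ : Param p | ¬ FullRank X θ.2.1} :=
    (measurable_fst.comp measurable_snd)
      (MeasurableSpace.measurableSet_top (s := {ξ | ¬ FullRank X ξ}))
  have hmp : MeasurableSet {θ : Param p | ¬ 0 < θ.1} :=
    (measurableSet_lt measurable_const measurable_fst).compl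
  have hmz : MeasurableSet {θ : Param p | ¬ ∀ j, j ∉ θ.2.1 → |θ.2.2 j| ≤ θ.1 * z₀} :=
    (measurableSet_spike z₀).compl
  -- The bound for the probability of `T` under `θ`. It is infinite on the null set of non-positive
  -- scales, where the likelihood is not a density of the data law.
  set G : Param p → ℝ≥0∞ := fun θ =>
    {θ : Param p | ¬ 0 < θ.1}.indicator (fun _ => ∞) θ +
    {θ : Param p | ¬ FullRank X θ.2.1}.indicator (fun _ => 1) θ +
    {θ : Param p | ¬ ((θ.2.1 \ ξs).card : ℝ) ≤ k}.indicator (fun _ => 1) θ +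
    {θ : Param p | ¬ ∀ j, j ∉ θ.2.1 → |θ.2.2 j| ≤ θ.1 * z₀}.indicator (fun _ => 1) θ +
    ENNReal.ofReal q with hG
  have hGm : Measurable G :=
    ((((measurable_const.indicator hmp).add (measurable_const.indicator hmf)).add
      (measurable_const.indicator hms)).add (measurable_const.indicator hmz)).add measurable_const
  have hGint : ∫⁻ θ, G θ ∂Q ≤ ENNReal.ofReal (a₁ + a₂ + q) := by
    have hz0 : Q {θ : Param p | ¬ 0 < θ.1} = 0 := prior_scale_nonpos hh₀ hh₁
    have hz1 : Q {θ : Param p | ¬ FullRank X θ.2.1} = 0 := prior_not_fullRank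
    rw [hG, lintegral_add_right _ measurable_const,
      lintegral_add_right _ (measurable_const.indicator hmz),
      lintegral_add_right _ (measurable_const.indicator hms),
      lintegral_add_right _ (measurable_const.indicator hmf),
      lintegral_indicator_const hmp, lintegral_indicator_const hmf,
      lintegral_indicator_const hms, lintegral_indicator_const hmz, hz0, hz1, lintegral_const]
    simp only [mul_zero, zero_add, one_mul]
    rw [ENNReal.ofReal_add (by positivity) hq0, ENNReal.ofReal_add ha₁ ha₂]
    gcongr
    exact mul_le_of_le_one_right (by simp) (hQle _)
  have hFG : ∀ θ ∈ Cᶜ, ∫⁻ Y in T, likelihood X Y θ ≤ G θ := by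
    rintro ⟨σ, ξ, β⟩ hθ
    by_cases hσ : 0 < σ
    swap
    · have : G (σ, ξ, β) = ∞ := by simp [hG, hσ]
      rw [this]; exact le_top
    rw [hF _ hσ]
    have hprob := isProbabilityMeasure_dataLaw X σ β
    simp only
    by_cases h1 : FullRank X ξ
    swap
    · refine prob_le_one.trans ?_
      simp only [hG, Set.indicator, Set.mem_ofPred_eq, h1, not_false_eq_true, if_true]
      exact le_add_right (le_add_right (le_add_right (le_add_self)))
    by_cases h2 : ((ξ \ ξs).card : ℝ) ≤ k
    swap
    · refine prob_le_one.trans ?_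
      simp only [hG, Set.indicator, Set.mem_ofPred_eq, h2, not_false_eq_true, if_true]
      exact le_add_right (le_add_right (le_add_self))
    by_cases h3 : ∀ j, j ∉ ξ → |β j| ≤ σ * z₀
    swap
    · refine prob_le_one.trans ?_
      simp only [hG, Set.indicator, Set.mem_ofPred_eq, h3, not_false_eq_true, if_true]
      exact le_add_right (le_add_self)
    refine le_trans ?_ (le_add_self : ENNReal.ofReal q ≤ G (σ, ξ, β))
    rw [dataLaw_apply X hTm]
    refine le_trans (measure_mono fun e he => ?_) (hq _ h2)
    rw [Finset.sdiff_union_self_eq_union]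
    intro hgood
    refine hθ (hC σ ξ β e _ hσ h2 h1 h3 hgood ?_ (hNY _))
    have := he (ξ \ ξs) ((hfloor _).2 h2)
    rwa [Finset.sdiff_union_self_eq_union] at this
  have hnum : ∫⁻ θ in Cᶜ, ∫⁻ Y in T, likelihood X Y θ ∂volume ∂Q ≤ ENNReal.ofReal (a₁ + a₂ + q) := by
    -- The set `C` need not be measurable, so its complement is enlarged to a measurable set on which
    -- the pointwise bound holds.
    have hMm : MeasurableSet {θ : Param p | ∫⁻ Y in T, likelihood X Y θ ≤ G θ} :=
      measurableSet_le hFm hGm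
    calc _ ≤ ∫⁻ θ in {θ : Param p | ∫⁻ Y in T, likelihood X Y θ ≤ G θ},
          ∫⁻ Y in T, likelihood X Y θ ∂volume ∂Q := lintegral_mono_set hFG
      _ ≤ ∫⁻ θ in {θ : Param p | ∫⁻ Y in T, likelihood X Y θ ≤ G θ}, G θ ∂Q :=
          setLIntegral_mono' hMm fun θ hθ => hθ
      _ ≤ ∫⁻ θ, G θ ∂Q := setLIntegral_le_lintegral _ _
      _ ≤ _ := hGint
  have htot : ∫⁻ θ, ∫⁻ Y, likelihood X Y θ ∂volume ∂Q ≠ ∞ := by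
    have hae : ∀ᵐ θ ∂Q, ∫⁻ Y, likelihood X Y θ ≤ 1 := by
      have h1 : ∀ᵐ θ ∂Q, 0 < θ.1 := by
        rw [ae_iff]; exact prior_scale_nonpos hh₀ hh₁
      filter_upwards [h1]
      rintro ⟨σ, ξ, β⟩ hσ
      have hprob := isProbabilityMeasure_dataLaw X σ β
      have := prob_le_one (μ := dataLaw X σ β) (s := Set.univ)
      rwa [dataLaw_eq_withDensity X hσ ξ β, withDensity_apply _ MeasurableSet.univ,
        Measure.restrict_univ] at this
    refine ((lintegral_mono_ae hae).trans_lt ?_).ne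
    rw [lintegral_const, one_mul]
    exact measure_lt_top _ _
  have hbayes := exists_posterior_bound (ν := (volume : Measure (Fin n → ℝ))) (Q := Q)
    (ℓ := fun Y θ => likelihood X Y θ) hlik (ℓs := fun Y => likelihood X Y (σs, ξs, βs))
    (measurable_likelihood_left X _)
    (fun Y => likelihood_ne_zero X Y hσs) (B := Cᶜ) (T := T) hTm
    (κ := ENNReal.ofReal κ) (δ := ENNReal.ofReal δ) (b := ENNReal.ofReal (a₁ + a₂ + q))
    (by simpa using hκ) ENNReal.ofReal_ne_top (by simpa using hδ) ENNReal.ofReal_ne_top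
    (fun Y hY => hev (N Y) Y (hNY Y) fun ζ hζ => hY ζ ((hfloor _).2 hζ)) hnum htot
  rw [← dataLaw_eq_withDensity X hσs ξs βs] at hbayes
  refine le_trans (measure_mono ?_) ((measure_union_le Tᶜ _).trans (add_le_add hTc hbayes |>.trans
    (le_of_eq ?_)))
  · intro Y hY
    by_cases hYT : Y ∈ T
    · right
      refine ⟨hYT, fun ⟨hZt, hZ0, hB⟩ => hY ?_⟩
      have hpost : ∀ B : Set (Param p), posteriorLaw X g π h₀ h₁ Y B =
          (∫⁻ θ, likelihood X Y θ ∂Q)⁻¹ * ∫⁻ θ in B, likelihood X Y θ ∂Q := by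
        intro B
        simp only [posteriorLaw, Measure.smul_apply, smul_eq_mul]
        rw [withDensity_apply _ MeasurableSet.univ, Measure.restrict_univ, withDensity_apply' _ B]
      have hpuniv : posteriorLaw X g π h₀ h₁ Y Set.univ = 1 := by
        rw [hpost, Measure.restrict_univ, ENNReal.inv_mul_cancel hZ0 hZt]
      have hPprob : IsProbabilityMeasure (posteriorLaw X g π h₀ h₁ Y) := ⟨hpuniv⟩
      have hcompl : (posteriorLaw X g π h₀ h₁ Y).real Cᶜ ≤ δ := by
        refine ENNReal.toReal_le_of_le_ofReal hδ.le ?_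
        rw [hpost, mul_comm, ← div_eq_mul_inv]
        exact ENNReal.div_le_of_le_mul hB
      have hun : 1 ≤ (posteriorLaw X g π h₀ h₁ Y).real C +
          (posteriorLaw X g π h₀ h₁ Y).real Cᶜ := by
        have := measureReal_union_le (μ := posteriorLaw X g π h₀ h₁ Y) C Cᶜ
        rwa [Set.union_compl_self, probReal_univ] at this
      linarith
    · exact Or.inl hYT
  · rw [← ENNReal.ofReal_mul hδ.le, ← ENNReal.ofReal_div_of_pos (by positivity),
      ← ENNReal.ofReal_add (by positivity) (by positivity)]

end Posterior

/-! ### Rates and exponential bounds -/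

section Rates

theorem natCast_mul_rate_sq {n p s : ℕ} (hn : 0 < n) : n * rate n p s ^ 2 = s * Real.log p := by
  have hn' : (0 : ℝ) < n := by exact_mod_cast hn
  have : 0 ≤ Real.log p := Real.log_natCast_nonneg p
  rw [rate, Real.sq_sqrt (by positivity)]
  field_simp

theorem natCast_rpow_eq_exp {p : ℕ} (hp : 0 < p) (x : ℝ) :
    (p : ℝ) ^ x = Real.exp (x * Real.log p) := by
  rw [Real.rpow_def_of_pos (by exact_mod_cast hp), mul_comm]

/-- The volume of the neighbourhood of the truth, a product of the window for the scale and of the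
windows for the active coefficients. It is at least `n⁻¹` for each active coefficient. -/
theorem exp_neg_le_rate_mul_pow {n p s : ℕ} (hn : 0 < n) (hnp : n < p) (hs : 0 < s)
    (hlog : 1 ≤ Real.log p) (hε : rate n p s ≤ 1) :
    Real.exp (-(s * Real.log p)) ≤ rate n p s * (rate n p s / s) ^ s := by
  have hn' : (0 : ℝ) < n := by exact_mod_cast hn
  have hs' : (0 : ℝ) < s := by exact_mod_cast hs
  have hp' : (0 : ℝ) < p := by exact_mod_cast hn.trans hnp
  have hε0 : 0 ≤ rate n p s := Real.sqrt_nonneg _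
  have hsq := natCast_mul_rate_sq (p := p) (s := s) hn
  have hsn : (s : ℝ) ≤ n := by
    calc (s : ℝ) = s * 1 := (mul_one _).symm
      _ ≤ s * Real.log p := by gcongr
      _ = n * rate n p s ^ 2 := hsq.symm
      _ ≤ n * 1 := by gcongr; exact pow_le_one₀ hε0 hε
      _ = n := mul_one _
  have h1 : (n : ℝ)⁻¹ ≤ rate n p s * (rate n p s / s) := by
    rw [inv_le_iff_one_le_mul₀ hn']
    have : rate n p s * (rate n p s / s) * n = Real.log p := by
      field_simp; linarith
    rwa [this]
  have h2 : (n : ℝ)⁻¹ ≤ rate n p s / s := by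
    rw [inv_le_iff_one_le_mul₀ hn', div_mul_eq_mul_div, le_div_iff₀ hs', one_mul]
    refine (abs_le_of_sq_le_sq' ?_ (by positivity)).2
    have h3 : (rate n p s * n) ^ 2 = n * (s * Real.log p) := by rw [← hsq]; ring
    rw [h3]
    calc (s : ℝ) ^ 2 = s * (s * 1) := by ring
      _ ≤ n * (s * Real.log p) := by gcongr
  obtain ⟨k, rfl⟩ := Nat.exists_eq_succ_of_ne_zero hs.ne'
  calc Real.exp (-((k.succ : ℕ) * Real.log p)) = (p : ℝ)⁻¹ ^ k.succ := by
        rw [Real.exp_neg, Real.exp_nat_mul, Real.exp_log hp', inv_pow]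
    _ ≤ (n : ℝ)⁻¹ ^ k.succ := by gcongr
    _ = (n : ℝ)⁻¹ * (n : ℝ)⁻¹ ^ k := by rw [pow_succ, mul_comm]
    _ ≤ (rate n p k.succ * (rate n p k.succ / k.succ)) * (rate n p k.succ / k.succ) ^ k := by
        gcongr
    _ = _ := by rw [pow_succ]; ring

/-- Constants to the power `s` are negligible against `exp (s log p)`. -/
theorem exists_exp_neg_le_mul_pow {c₁ c₂ θ : ℝ} (h₁ : 0 < c₁) (h₂ : 0 < c₂) (hθ : 0 < θ) :
    ∃ ℓ : ℝ, ∀ l, ℓ ≤ l → ∀ s : ℕ, 0 < s → Real.exp (-(θ * (s * l))) ≤ c₁ * c₂ ^ s := by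
  refine ⟨(|Real.log c₁| + |Real.log c₂|) / θ, fun l hl s hs => ?_⟩
  have hs' : (1 : ℝ) ≤ s := by exact_mod_cast hs
  rw [div_le_iff₀ hθ] at hl
  have h : c₁ * c₂ ^ s = Real.exp (Real.log c₁ + s * Real.log c₂) := by
    rw [Real.exp_add, Real.exp_nat_mul, Real.exp_log h₁, Real.exp_log h₂]
  rw [h, Real.exp_le_exp]
  have a1 := neg_abs_le (Real.log c₁)
  have a2 := neg_abs_le (Real.log c₂)
  have a3 := abs_nonneg (Real.log c₁)
  calc -(θ * (s * l)) = -(s * (l * θ)) := by ring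
    _ ≤ -(s * (|Real.log c₁| + |Real.log c₂|)) := by gcongr
    _ ≤ Real.log c₁ + s * Real.log c₂ := by nlinarith

end Rates

/-- The noise is atypical for a given model with probability at most `3 exp (-(B + τ) L)`, where
`L = n ε²`: the exponent beats both the number of models and the prior mass near the truth. -/
theorem stdGaussian_compl_goodNoise_le_exp {n p s : ℕ} (X : Matrix (Fin n) (Fin p) ℝ)
    {γ : Finset (Fin p)} {K B t b u τ ε l : ℝ} (hε : 0 ≤ ε) (hL : n * ε ^ 2 = s * l)
    (ht0 : 0 ≤ t) (ht : 8 * B ≤ t ^ 2) (htε : 16 * (t * ε) ≤ 1)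
    (hu0 : 0 ≤ u) (hu : u < 1 / 2) (hτB : 2 * τ ≤ B) (hub : B + 2 * τ ≤ u * b ^ 2)
    (hl : (K + 1) * Real.log (Real.sqrt (1 - 2 * u))⁻¹ ≤ τ * l) (hl0 : 0 ≤ l)
    (hγ : (γ.card : ℝ) ≤ (K + 1) * s) :
    stdGaussian (EuclideanSpace ℝ (Fin n)) (goodNoise X γ (t * ε) (b ^ 2 * (n * ε ^ 2)))ᶜ ≤
      ENNReal.ofReal (3 * Real.exp (-((B + τ) * (s * l)))) := by
  have hsl : 0 ≤ s * l := by positivity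
  have hD : 1 ≤ (Real.sqrt (1 - 2 * u))⁻¹ := by
    rw [one_le_inv₀ (Real.sqrt_pos.2 (by linarith)), Real.sqrt_le_one]
    linarith
  refine (stdGaussian_compl_goodNoise_le X γ (by positivity) (by linarith) hu0 hu).trans
    (ENNReal.ofReal_le_ofReal ?_)
  have h1 : Real.exp (-(n * (t * ε) ^ 2 / 4 * (1 - 4 * (t * ε)))) ≤
      Real.exp (-((B + τ) * (s * l))) := by
    rw [Real.exp_le_exp, neg_le_neg_iff]
    have e : n * (t * ε) ^ 2 / 4 = t ^ 2 / 4 * (s * l) := by rw [← hL]; ring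
    rw [e]
    calc (B + τ) * (s * l) ≤ (8 * B / 4 * (3 / 4)) * (s * l) := by gcongr; linarith
      _ = 8 * B / 4 * (s * l) * (3 / 4) := by ring
      _ ≤ t ^ 2 / 4 * (s * l) * (1 - 4 * (t * ε)) := by gcongr; linarith
  have h2 : Real.exp (-(u * (b ^ 2 * (n * ε ^ 2)))) * (Real.sqrt (1 - 2 * u))⁻¹ ^ γ.card ≤
      Real.exp (-((B + τ) * (s * l))) := by
    have h3 : (Real.sqrt (1 - 2 * u))⁻¹ ^ γ.card ≤ Real.exp (τ * (s * l)) := by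
      rw [← Real.rpow_natCast]
      calc _ ≤ (Real.sqrt (1 - 2 * u))⁻¹ ^ ((K + 1) * (s : ℝ)) :=
            Real.rpow_le_rpow_of_exponent_le hD hγ
        _ = Real.exp (s * ((K + 1) * Real.log (Real.sqrt (1 - 2 * u))⁻¹)) := by
            rw [Real.rpow_def_of_pos (by linarith)]; ring_nf
        _ ≤ Real.exp (s * (τ * l)) := by gcongr
        _ = _ := by ring_nf
    calc _ ≤ Real.exp (-(u * (b ^ 2 * (n * ε ^ 2)))) * Real.exp (τ * (s * l)) := by gcongr
      _ = Real.exp (-(u * b ^ 2 * (s * l)) + τ * (s * l)) := by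
          rw [← Real.exp_add, hL]; ring_nf
      _ ≤ Real.exp (-((B + 2 * τ) * (s * l)) + τ * (s * l)) := by gcongr
      _ = _ := by ring_nf
  linarith

/-- The evidence is at least `exp (-(A₁ + A₃ + 1 + 2 θ) L)` times the true density. -/
theorem exp_mul_likelihood_le_evidence {n p : ℕ} {X : Matrix (Fin n) (Fin p) ℝ} {g : ℝ → ℝ}
    {π : Finset (Fin p) → ℝ} {h₀ : Measure ℝ} {h₁ : ℝ → ℝ}
    (hg : IsDensityOn (Set.Ioi 0) g) (hh₀ : IsProbabilityMeasure h₀)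
    (hh₁ : IsDensityOn Set.univ h₁) (hπ : ∀ ξ, 0 ≤ π ξ) (hsum : ∑ ξ, π ξ = 1) (h0 : 0 < π ∅)
    (hcol : ∀ j, ‖WithLp.toLp 2 (Xᵀ j)‖ = Real.sqrt n) (hn : 0 < n) (hnp : n < p)
    {σs z₀ t b η c d A₁ A₃ K θ : ℝ} {βs : Fin p → ℝ} (hσs : 0 < σs)
    (hfull : FullRank X (activeSet βs)) (hs : 0 < sparsity βs) (hlog : 1 ≤ Real.log p)
    (hε1 : rate n p (sparsity βs) ≤ 1) (hη0 : 0 ≤ η) (hη1 : η ≤ 1) (ht0 : 0 ≤ t)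
    (htε : t * rate n p (sparsity βs) ≤ 1) (hb0 : 0 ≤ b) (hηθ : η * (η + t + b) ≤ θ)
    (hz : p * |z₀| ≤ η * rate n p (sparsity βs) / 2)
    (hc0 : 0 ≤ c) (hc : ∀ v ∈ Set.Icc (σs ^ 2) (2 * σs ^ 2), c ≤ g v)
    (hd0 : 0 ≤ d) (hd : ∀ z, |z| ≤ slabRadius n σs βs → d * (p : ℝ) ^ (-A₃) ≤ h₁ z)
    (htrue : (p : ℝ) ^ (-(A₁ * sparsity βs)) ≤ π (activeSet βs))
    (hq : h₀.real {z | z₀ < |z|} ≤ Real.exp (-(n : ℝ))) (hpn : p * Real.exp (-(n : ℝ)) ≤ 1 / 2)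
    (hconst : Real.exp (-(θ * (sparsity βs * Real.log p))) ≤
      (c * σs ^ 2 * η / 2) * (d * η) ^ sparsity βs)
    (hK : 1 ≤ K * sparsity βs)
    {e : EuclideanSpace ℝ (Fin n)} {Y : Fin n → ℝ} (hY : Y = X *ᵥ βs + σs • e.ofLp)
    (hgood : ∀ ζ : Finset (Fin p), (ζ.card : ℝ) ≤ K * sparsity βs →
      e ∈ goodNoise X (ζ ∪ activeSet βs) (t * rate n p (sparsity βs))
        (b ^ 2 * (n * rate n p (sparsity βs) ^ 2))) :
    ENNReal.ofReal (Real.exp (-((A₁ + A₃ + 1 + 2 * θ) * (sparsity βs * Real.log p)))) *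
      likelihood X Y (σs, activeSet βs, βs) ≤ ∫⁻ θ, likelihood X Y θ ∂(prior X g π h₀ h₁) := by
  set s := sparsity βs with hsdef
  set ε := rate n p s with hεdef
  have hε0 : 0 ≤ ε := Real.sqrt_nonneg _
  have hp0 : 0 < p := hn.trans hnp
  have hL : n * ε ^ 2 = s * Real.log p := natCast_mul_rate_sq hn
  have hinner : ∀ j, |inner ℝ e (WithLp.toLp 2 (Xᵀ j))| ≤ n * (b * ε) := by
    intro j
    refine abs_inner_col_le_of_goodNoise hcol (by positivity) (x := t * ε)
      (γ := {j} ∪ activeSet βs) ?_ (by simp)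
    -- A single column is an admissible model, as `1 ≤ K s`.
    have := hgood {j} (by simpa using hK)
    rwa [show b ^ 2 * (n * ε ^ 2) = n * (b * ε) ^ 2 by ring] at this
  have hnorm : n * (1 - t * ε) ≤ ‖e‖ ^ 2 := by
    have := (abs_le.1 (hgood ∅ (by simp; positivity)).1).1
    linarith
  have hηε : η * ε ≤ ε := mul_le_of_le_one_left hε0 hη1
  have hev := evidence_ge (X := X) (π := π) hg hh₀ hh₁ hcol hY hσs htε (by positivity) hnorm
    (h := b * ε) (by positivity) hinner (y := η * ε) (by positivity) hs hz hc0 (fun v hv => hc v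
      ⟨hv.1, hv.2.trans (by nlinarith [sq_nonneg σs])⟩)
    (a := d * (p : ℝ) ^ (-A₃)) (by positivity) hd (fun j hj => by
      have h1 : ‖βs j / σs‖₊ ≤ (activeSet βs).sup fun j => ‖βs j / σs‖₊ :=
        Finset.le_sup (f := fun j => ‖βs j / σs‖₊) hj
      have h2 : |βs j / σs| ≤ (((activeSet βs).sup fun j => ‖βs j / σs‖₊ : ℝ≥0) : ℝ) := by
        exact_mod_cast h1
      unfold slabRadius
      linarith)
    (q := Real.exp (-(n : ℝ))) (Real.exp_pos _).le (by simp) hq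
  refine le_trans ?_ hev
  have hw : Real.exp (-(A₁ * (s * Real.log p))) ≤ modelWeight X π (activeSet βs) := by
    refine le_trans (le_of_eq ?_) (htrue.trans (le_modelWeight hπ hsum h0 hfull))
    rw [natCast_rpow_eq_exp hp0]; ring_nf
  have hbox : Real.exp (-((A₃ + 1 + θ) * (s * Real.log p))) ≤ c * (σs ^ 2 * (η * ε)) *
      ((d * (p : ℝ) ^ (-A₃) * (η * ε / s)) ^ s * (1 - p * Real.exp (-(n : ℝ)))) := by
    have hvol := exp_neg_le_rate_mul_pow hn hnp hs hlog hε1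
    have hpA : ((p : ℝ) ^ (-A₃)) ^ s = Real.exp (-(A₃ * (s * Real.log p))) := by
      rw [natCast_rpow_eq_exp hp0, ← Real.exp_nat_mul]; ring_nf
    calc _ = Real.exp (-(θ * (s * Real.log p))) * Real.exp (-(A₃ * (s * Real.log p))) *
          Real.exp (-(s * Real.log p)) := by
          rw [← Real.exp_add, ← Real.exp_add]; ring_nf
      _ ≤ (c * σs ^ 2 * η / 2) * (d * η) ^ s * ((p : ℝ) ^ (-A₃)) ^ s * (ε * (ε / s) ^ s) := by
          rw [hpA]; gcongr
      _ = c * (σs ^ 2 * (η * ε)) * ((d * (p : ℝ) ^ (-A₃) * (η * ε / s)) ^ s * (1 / 2)) := by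
          rw [show d * (p : ℝ) ^ (-A₃) * (η * ε / s) = d * η * (p : ℝ) ^ (-A₃) * (ε / s) by ring]
          simp only [mul_pow]
          ring
      _ ≤ _ := by gcongr; linarith
  have hlr : Real.exp (-(θ * (s * Real.log p))) ≤
      Real.exp (-(n * ((η * ε) ^ 2 + t * ε * (η * ε) + b * ε * (η * ε)))) := by
    rw [Real.exp_le_exp, neg_le_neg_iff, ← hL]
    calc _ = η * (η + t + b) * (n * ε ^ 2) := by ring
      _ ≤ _ := by gcongr
  have hbox0 : 0 ≤ c * (σs ^ 2 * (η * ε)) := by positivity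
  calc _ = ENNReal.ofReal (Real.exp (-(A₁ * (s * Real.log p)))) *
        (ENNReal.ofReal (Real.exp (-(θ * (s * Real.log p)))) *
          likelihood X Y (σs, activeSet βs, βs) *
          ENNReal.ofReal (Real.exp (-((A₃ + 1 + θ) * (s * Real.log p))))) := by
        rw [show -((A₁ + A₃ + 1 + 2 * θ) * (s * Real.log p)) = -(A₁ * (s * Real.log p)) +
          (-(θ * (s * Real.log p)) + -((A₃ + 1 + θ) * (s * Real.log p))) by ring,
          Real.exp_add, Real.exp_add, ENNReal.ofReal_mul (Real.exp_pos _).le,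
          ENNReal.ofReal_mul (Real.exp_pos _).le]
        ring
    _ ≤ _ := by
        rw [← ENNReal.ofReal_mul hbox0]
        gcongr

/-- The total error probability, in terms of `L = s l`: the first term bounds the probability of
atypical noise, the second one comes from Markov's inequality. The gap `w - D = 8 θ` pays for the
posterior level `exp (-θ L)`, for the slack `2 θ` in the evidence, for the constants, and for the
resulting rate. -/
theorem error_sum_le {p s : ℕ} {K B τ θ D w c l : ℝ} (hp : 0 < p) (hl : l = Real.log p)
    (hs : 0 < s) (hK : 0 ≤ K) (hKB : K ≤ B) (hτ : 0 < τ) (hθ : 0 < θ) (hwB : w ≤ B)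
    (hw : D + 8 * θ = w) (hc : 0 ≤ c) (hl1 : 4 * K ≤ τ * l)
    (hl2 : Real.log (c + 7) ≤ min (τ / 4) θ * l) (hl0 : 0 ≤ l) :
    (K * s + 1) * (p : ℝ) ^ (K * s) * (3 * Real.exp (-((B + τ) * (s * l)))) +
      (c * Real.exp (-(w * (s * l))) + Real.exp (-(w * (s * l))) +
        3 * Real.exp (-((B + τ) * (s * l)))) /
        (Real.exp (-(θ * s * l)) * Real.exp (-((D + 2 * θ) * (s * l)))) ≤
      Real.exp (-(min (τ / 2) θ * s * l)) := by
  have hs' : (1 : ℝ) ≤ s := by exact_mod_cast hs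
  set L := s * l with hL
  have hL0 : 0 ≤ L := by positivity
  have hlL : l ≤ L := by rw [hL]; nlinarith
  set m := min (τ / 4) θ with hm
  set m' := min (τ / 2) θ with hm'
  have hm0 : 0 < m := lt_min (by positivity) hθ
  have hcL : (c + 7) * Real.exp (-(m * L)) ≤ 1 := by
    have h7 : 0 < c + 7 := by linarith
    calc (c + 7) * Real.exp (-(m * L)) = Real.exp (Real.log (c + 7) + -(m * L)) := by
          rw [Real.exp_add, Real.exp_log h7]
      _ ≤ Real.exp 0 := by
          gcongr
          have : m * l ≤ m * L := by gcongr
          linarith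
      _ = 1 := Real.exp_zero
  have t1 : (K * s + 1) * (p : ℝ) ^ (K * s) * (3 * Real.exp (-((B + τ) * L))) ≤
      3 * Real.exp (-(m * L) - m' * L) := by
    have a1 : K * s + 1 ≤ Real.exp (τ / 4 * L) := by
      refine (Real.add_one_le_exp _).trans ?_
      rw [Real.exp_le_exp, hL]
      have : K * s * 4 ≤ τ * l * s := by
        calc K * s * 4 = 4 * K * s := by ring
          _ ≤ _ := by gcongr
      linarith
    have a2 : (p : ℝ) ^ (K * s) = Real.exp (K * L) := by
      rw [natCast_rpow_eq_exp hp, ← hl, hL]; ring_nf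
    rw [a2]
    calc _ ≤ Real.exp (τ / 4 * L) * Real.exp (K * L) * (3 * Real.exp (-((B + τ) * L))) := by gcongr
      _ = 3 * Real.exp (τ / 4 * L + K * L + -((B + τ) * L)) := by
          rw [Real.exp_add, Real.exp_add]; ring
      _ ≤ _ := by
          gcongr
          have b1 : m ≤ τ / 4 := min_le_left _ _
          have b2 : m' ≤ τ / 2 := min_le_left _ _
          have : 0 ≤ (B - K + (τ / 4 - m) + (τ / 2 - m')) * L :=
            mul_nonneg (by linarith) hL0
          linarith
  have t2 : (c * Real.exp (-(w * L)) + Real.exp (-(w * L)) + 3 * Real.exp (-((B + τ) * L))) /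
        (Real.exp (-(θ * s * l)) * Real.exp (-((D + 2 * θ) * L))) ≤
      (c + 4) * Real.exp (-(m * L) - m' * L) := by
    rw [div_le_iff₀ (by positivity), ← Real.exp_add, mul_assoc, ← Real.exp_add]
    have a1 : Real.exp (-((B + τ) * L)) ≤ Real.exp (-(w * L)) := by
      rw [Real.exp_le_exp]
      have : 0 ≤ (B + τ - w) * L := mul_nonneg (by linarith) hL0
      linarith
    have a2 : Real.exp (-(w * L)) ≤
        Real.exp (-(m * L) - m' * L + (-(θ * s * l) + -((D + 2 * θ) * L))) := by
      rw [Real.exp_le_exp]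
      have b1 : m ≤ θ := min_le_right _ _
      have b2 : m' ≤ θ := min_le_right _ _
      have e : θ * s * l = θ * L := by rw [hL]; ring
      have : 0 ≤ (3 * θ + (θ - m) + (θ - m')) * L := mul_nonneg (by linarith) hL0
      rw [e, ← hw]
      linarith
    calc _ ≤ (c + 4) * Real.exp (-(w * L)) := by linarith
      _ ≤ _ := by gcongr
  calc _ ≤ (c + 7) * Real.exp (-(m * L) - m' * L) := by linarith
    _ = (c + 7) * Real.exp (-(m * L)) * Real.exp (-(m' * s * l)) := by
        rw [mul_assoc, ← Real.exp_add, hL]; ring_nf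
    _ ≤ _ := mul_le_of_le_one_left (Real.exp_pos _).le hcL

end SpikeSlab

theorem theorem1 (A₁ A₂ A₃ K M₁ M₂ : ℝ) (hA₁ : 0 < A₁) (hA₂ : 0 < A₂) (hA₃ : 0 < A₃)
    (hK : 1 ≤ K) (hAK : A₁ + A₃ + 1 < A₂ * K)
    (hM₁ : Real.sqrt (8 * max A₂ 1 * K) < M₁) (hM₂ : Real.sqrt (8 * max A₂ 1 * K) < M₂) :
    ∃ C₁ C₂ : ℝ, 0 < C₁ ∧ 0 < C₂ ∧
      ∀ (p : ℕ → ℕ) (X : ∀ n, Matrix (Fin n) (Fin (p n)) ℝ)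
        (σs : ℝ) (βs : ∀ n, Fin (p n) → ℝ)
        (g : ℝ → ℝ) (π : ∀ n, Finset (Fin (p n)) → ℝ)
        (h₀ : ℕ → Measure ℝ) (h₁ : ℕ → ℝ → ℝ) (z₀ lam : ℕ → ℝ),
        0 < σs →
        Regime p X βs →
        PriorAssumption A₁ A₂ A₃ p σs βs g π h₀ h₁ z₀ →
        (∀ n, lam n = muev (X n) (activeSet (βs n)) ((K + 1) * sparsity (βs n))) →
        (∀ᶠ n in atTop, 0 < lam n) →
        ∀ᶠ n in atTop,
          1 - Real.exp (-(C₂ * sparsity (βs n) * Real.log (p n))) ≤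
            (dataLaw (X n) σs (βs n)).real
              {Y | 1 - Real.exp (-(C₁ * sparsity (βs n) * Real.log (p n))) ≤
                (posteriorLaw (X n) g (π n) (h₀ n) (h₁ n) Y).real
                  (contractionSet (X n) σs (βs n) (z₀ n) M₁ M₂ K (lam n)
                    (rate n (p n) (sparsity (βs n))))} := by
  have hK0 : 0 < K := by linarith
  set B := max A₂ 1 * K with hBdef
  have hB8 : 8 * max A₂ 1 * K = 8 * B := by rw [hBdef]; ring
  have hKB : K ≤ B := le_mul_of_one_le_left hK0.le (le_max_right _ _)
  have hAB : A₂ * K ≤ B := mul_le_mul_of_nonneg_right (le_max_left _ _) hK0.le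
  have hB0 : 0 < B := hK0.trans_le hKB
  rw [hB8] at hM₁ hM₂
  have hsqB : Real.sqrt (8 * B) ^ 2 = 8 * B := Real.sq_sqrt (by linarith)
  have hsB : 0 < Real.sqrt (8 * B) := Real.sqrt_pos.2 (by linarith)
  -- The thresholds `t` and `b` of good noise, and the parameter `u` of the Chernoff bound. With
  -- `b² > 2 B` there is room for `u b² > B` with `u < 1 / 2`.
  obtain ⟨t, htB, htM⟩ := exists_between hM₁
  obtain ⟨b₂, hbB, hbM⟩ := exists_between hM₂
  set b := b₂ / 2 with hbdef
  have ht0 : 0 < t := hsB.trans htB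
  have hb0 : 0 < b := by rw [hbdef]; linarith
  have ht2 : 8 * B ≤ t ^ 2 := by rw [← hsqB]; gcongr
  have hb2 : 2 * B < b ^ 2 := by
    have : Real.sqrt (8 * B) ^ 2 < b₂ ^ 2 := by gcongr
    rw [hbdef]; linarith
  have hbM₂ : 2 * b < M₂ := by rw [hbdef]; linarith
  obtain ⟨u, huB, hu⟩ : ∃ u, B / b ^ 2 < u ∧ u < 1 / 2 := exists_between (by
    rw [div_lt_iff₀ (by positivity)]; linarith)
  have hu0 : 0 < u := lt_trans (by positivity) huB
  rw [div_lt_iff₀ (by positivity)] at huB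
  set τ := min ((u * b ^ 2 - B) / 2) (B / 2) with hτdef
  have hτ0 : 0 < τ := lt_min (by linarith) (by linarith)
  have hτB : 2 * τ ≤ B := by linarith [min_le_right ((u * b ^ 2 - B) / 2) (B / 2)]
  have hub : B + 2 * τ ≤ u * b ^ 2 := by linarith [min_le_left ((u * b ^ 2 - B) / 2) (B / 2)]
  set θ := (A₂ * K - (A₁ + A₃ + 1)) / 8 with hθdef
  have hθ0 : 0 < θ := by rw [hθdef]; linarith
  -- The radius `η ε` of the neighbourhood of the truth; `η ε` also bounds the inactive
  -- coefficients.
  obtain ⟨η, ⟨⟨hη1, hη2, hη3⟩, hη4⟩, hη0⟩ : ∃ η : ℝ, ((η < 1 ∧ t + 4 * η < M₁ ∧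
      b + (b + 2 * η) < M₂) ∧ η * (η + t + b) < θ) ∧ 0 < η := by
    have e1 : ∀ᶠ η : ℝ in 𝓝 0, η < 1 := eventually_lt_nhds one_pos
    have e2 : ∀ᶠ η : ℝ in 𝓝 0, t + 4 * η < M₁ :=
      (by fun_prop : ContinuousAt (fun η : ℝ => t + 4 * η) 0).eventually_lt continuousAt_const
        (by simpa using htM)
    have e3 : ∀ᶠ η : ℝ in 𝓝 0, b + (b + 2 * η) < M₂ :=
      (by fun_prop : ContinuousAt (fun η : ℝ => b + (b + 2 * η)) 0).eventually_lt
        continuousAt_const (by linarith)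
    have e4 : ∀ᶠ η : ℝ in 𝓝 0, η * (η + t + b) < θ :=
      (by fun_prop : ContinuousAt (fun η : ℝ => η * (η + t + b)) 0).eventually_lt
        continuousAt_const (by simpa using hθ0)
    exact ((((e1.and (e2.and e3)).and e4).filter_mono nhdsWithin_le_nhds).and
      (self_mem_nhdsWithin : Set.Ioi (0 : ℝ) ∈ 𝓝[>] 0)).exists
  -- A bound for `σ / σs` on the contraction set, close to `1`.
  obtain ⟨ρ, hρ1, hρ2⟩ : ∃ ρ, 1 < ρ ∧ ρ < (M₂ - b) / (b + 2 * η) := exists_between (by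
    rw [lt_div_iff₀ (by positivity)]; linarith)
  rw [lt_div_iff₀ (by positivity)] at hρ2
  refine ⟨θ, min (τ / 2) θ, hθ0, lt_min (by linarith) hθ0, ?_⟩
  intro p X σs βs g π h₀ h₁ z₀ lam hσs hreg hprior hlam hlam0
  -- Small values of the rate.
  have hsmall : ∀ᶠ x : ℝ in 𝓝 0, 16 * (t * x) ≤ 1 ∧ x ≤ 1 ∧
      t + b ^ 2 * x + 4 * η + η ^ 2 * x ≤ M₁ ∧ M₁ * x < 1 ∧
      (1 + M₁ * x) / (1 - M₁ * x) ≤ ρ ^ 2 ∧ (A₂ * K + 1) * x ^ 2 ≤ 1 := by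
    have e1 : ∀ᶠ x : ℝ in 𝓝 0, 16 * (t * x) < 1 :=
      (by fun_prop : ContinuousAt (fun x : ℝ => 16 * (t * x)) 0).eventually_lt
        continuousAt_const (by simp)
    have e2 : ∀ᶠ x : ℝ in 𝓝 0, x < 1 := eventually_lt_nhds one_pos
    have e3 : ∀ᶠ x : ℝ in 𝓝 0, t + b ^ 2 * x + 4 * η + η ^ 2 * x < M₁ :=
      (by fun_prop : ContinuousAt (fun x : ℝ => t + b ^ 2 * x + 4 * η + η ^ 2 * x) 0).eventually_lt
        continuousAt_const (by simpa using hη2)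
    have e4 : ∀ᶠ x : ℝ in 𝓝 0, M₁ * x < 1 :=
      (by fun_prop : ContinuousAt (fun x : ℝ => M₁ * x) 0).eventually_lt
        continuousAt_const (by simp)
    have e5 : ∀ᶠ x : ℝ in 𝓝 0, (1 + M₁ * x) / (1 - M₁ * x) < ρ ^ 2 :=
      (ContinuousAt.div (by fun_prop) (by fun_prop) (by simp) :
        ContinuousAt (fun x : ℝ => (1 + M₁ * x) / (1 - M₁ * x)) 0).eventually_lt
        continuousAt_const (by simpa using one_lt_pow₀ hρ1 two_ne_zero)
    have e6 : ∀ᶠ x : ℝ in 𝓝 0, (A₂ * K + 1) * x ^ 2 < 1 :=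
      (by fun_prop : ContinuousAt (fun x : ℝ => (A₂ * K + 1) * x ^ 2) 0).eventually_lt
        continuousAt_const (by simp)
    filter_upwards [e1, e2, e3, e4, e5, e6] with x h1 h2 h3 h4 h5 h6
    exact ⟨h1.le, h2.le, h3.le, h4, h5.le, h6.le⟩
  have hε := hreg.rate_tendsto.eventually hsmall
  -- Large values of `log p`.
  have hlogp : Tendsto (fun n => Real.log (p n)) atTop atTop := by
    refine Real.tendsto_log_atTop.comp (tendsto_natCast_atTop_atTop.comp ?_)
    exact tendsto_atTop_mono' _ (hreg.lt_dim.mono fun n hn => hn.le) tendsto_id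
  -- The density of the variance near the truth.
  obtain ⟨c, hc0, hc⟩ : ∃ c, 0 < c ∧ ∀ v ∈ Set.Icc (σs ^ 2) (2 * σs ^ 2), c ≤ g v := by
    have hss : 0 < σs ^ 2 := by positivity
    have hsub : Set.Icc (σs ^ 2) (2 * σs ^ 2) ⊆ Set.Ioi 0 := fun v hv => hss.trans_le hv.1
    obtain ⟨v, hv, hmin⟩ := isCompact_Icc.exists_isMinOn
      (Set.nonempty_Icc.2 (by linarith : σs ^ 2 ≤ 2 * σs ^ 2))
      (hprior.variance_continuous.mono hsub)
    exact ⟨g v, hprior.variance_pos v (hsub hv), fun w hw => hmin hw⟩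
  obtain ⟨c₀, hc₀, hempty⟩ := hprior.model_empty.2.exists_pos
  rw [IsBigOWith] at hempty
  obtain ⟨d₀, hd₀, hslab⟩ := hprior.slab_lower.exists_pos
  rw [IsBigOWith] at hslab
  have hspike := hprior.spike_rate.def (c := η / 2) (by positivity)
  obtain ⟨ℓ, hℓ⟩ := exists_exp_neg_le_mul_pow (c₁ := c * σs ^ 2 * η / 2) (c₂ := d₀⁻¹ * η)
    (θ := θ) (by positivity) (by positivity) hθ0
  have hAK0 : 0 < A₂ * K := by positivity
  filter_upwards [hε, hlam0, hempty, hslab, hspike, hreg.lt_dim, hreg.norm_col, hreg.nonempty,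
    hreg.fullRank, hprior.model_true, hprior.model_tail, hprior.spike_tail, eventually_gt_atTop 0,
    hlogp.eventually_ge_atTop 1, hlogp.eventually_ge_atTop ℓ,
    hlogp.eventually_ge_atTop (4 * K / τ),
    hlogp.eventually_ge_atTop (Real.log (c₀ + 7) / min (τ / 4) θ),
    hlogp.eventually_ge_atTop ((K + 1) * Real.log (Real.sqrt (1 - 2 * u))⁻¹ / τ),
    hlogp.eventually_ge_atTop (Real.log 2 / (A₂ * K))]
    with n hεn hlamn hemptyn hslabn hspiken hnp hcol hne hfull htrue htail hstail hn hl1 hlℓ hlK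
      hlc hlu hl2
  obtain ⟨hεt, hε1, hεM, hMε, hερ, hεA⟩ := hεn
  have hs : 0 < sparsity (βs n) := Finset.card_pos.2 hne
  have hs1 : (1 : ℝ) ≤ sparsity (βs n) := by exact_mod_cast hs
  have hn' : (0 : ℝ) < n := by exact_mod_cast hn
  have hp : 0 < p n := hn.trans hnp
  have hp' : (0 : ℝ) < p n := by exact_mod_cast hp
  have hL := natCast_mul_rate_sq (p := p n) (s := sparsity (βs n)) hn
  set s := sparsity (βs n) with hsdef
  set ε := rate n (p n) s with hεdef
  set l := Real.log (p n) with hldef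
  have hl0 : 0 ≤ l := by linarith
  have hε0 : 0 ≤ ε := Real.sqrt_nonneg _
  have hlsl : l ≤ s * l := le_mul_of_one_le_left hl0 hs1
  have hKs : 1 ≤ K * s := one_le_mul_of_one_le_of_one_le hK hs1
  have hprob := isProbabilityMeasure_dataLaw (X n) σs (βs n)
  have hπ0 : 0 < π n ∅ := by
    rcases (hprior.model_nonneg n ∅).lt_or_eq with h | h
    · exact h
    · rw [← h] at hemptyn; norm_num at hemptyn
  have hπc : (π n ∅)⁻¹ ≤ c₀ := by
    rw [Real.norm_of_nonneg hπ0.le, norm_one] at hemptyn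
    rwa [inv_le_iff_one_le_mul₀ hπ0]
  have hz : p n * |z₀ n| ≤ η * ε / 2 := by
    have h1 : Real.sqrt (l / n) ≤ ε := Real.sqrt_le_sqrt (by gcongr)
    rw [Real.norm_of_nonneg (by positivity : 0 ≤ 1 / (p n : ℝ) * Real.sqrt (l / n)),
      Real.norm_eq_abs] at hspiken
    calc p n * |z₀ n| ≤ p n * (η / 2 * (1 / (p n : ℝ) * Real.sqrt (l / n))) := by gcongr
      _ = η / 2 * Real.sqrt (l / n) := by field_simp
      _ ≤ η / 2 * ε := by gcongr
      _ = _ := by ring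
  -- The infimum of the slab density is a true lower bound, since the density is non-negative.
  have hslab' : ∀ z, |z| ≤ slabRadius n σs (βs n) → d₀⁻¹ * (p n : ℝ) ^ (-A₃) ≤ h₁ n z := by
    intro z hz
    have hnn : ∀ z, 0 ≤ h₁ n z := fun z => (hprior.slab_density n).nonneg z trivial
    rw [Real.norm_of_nonneg (by positivity),
      Real.norm_of_nonneg (Real.iInf_nonneg fun z => hnn _)] at hslabn
    rw [inv_mul_le_iff₀ hd₀]
    refine hslabn.trans (mul_le_mul_of_nonneg_left ?_ hd₀.le)
    exact ciInf_le ⟨0, by rintro _ ⟨z, rfl⟩; exact hnn _⟩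
      (⟨z, hz⟩ : {z : ℝ // |z| ≤ slabRadius n σs (βs n)})
  -- The spikes fail with probability `exp (log p - n)`, where `n = L / ε²` exceeds any multiple of
  -- `L` as `ε` tends to `0`.
  have hpn : p n * Real.exp (-(n : ℝ)) ≤ Real.exp (-(A₂ * K * (s * l))) := by
    calc p n * Real.exp (-(n : ℝ)) = Real.exp (l + -(n : ℝ)) := by
          rw [Real.exp_add, hldef, Real.exp_log hp']
      _ ≤ _ := by
          rw [Real.exp_le_exp]
          have : (A₂ * K + 1) * (s * l) ≤ n := by
            calc (A₂ * K + 1) * (s * l) = n * ((A₂ * K + 1) * ε ^ 2) := by rw [← hL]; ring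
              _ ≤ n * 1 := by gcongr
              _ = n := mul_one _
          linarith
  have hhalf : Real.exp (-(A₂ * K * (s * l))) ≤ 1 / 2 := by
    rw [div_le_iff₀ hAK0] at hl2
    have h2 : Real.log 2 ≤ A₂ * K * (s * l) := by
      calc Real.log 2 ≤ l * (A₂ * K) := hl2
        _ ≤ s * l * (A₂ * K) := by gcongr
        _ = _ := by ring
    calc Real.exp (-(A₂ * K * (s * l))) ≤ Real.exp (-Real.log 2) := by gcongr
      _ = 1 / 2 := by rw [Real.exp_neg, Real.exp_log two_pos, one_div]
  have hcardγ : ∀ ζ : Finset (Fin (p n)), (ζ.card : ℝ) ≤ K * s →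
      ((ζ ∪ activeSet (βs n)).card : ℝ) ≤ (K + 1) * s := by
    intro ζ hζ
    have h1 : ((ζ ∪ activeSet (βs n)).card : ℝ) ≤ ζ.card + (s : ℕ) := by
      exact_mod_cast Finset.card_union_le ζ (activeSet (βs n))
    linarith
  have hbound := dataLaw_posterior_lt_le (X := X n) (π := π n) (h₀ := h₀ n) (h₁ := h₁ n)
    hprior.variance_density (hprior.spike_prob n) (hprior.slab_density n) (hprior.model_nonneg n)
    hπ0 hp (σs := σs) (z₀ := z₀ n) (x := t * ε) (r := b ^ 2 * (n * ε ^ 2))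
    (q := 3 * Real.exp (-((B + τ) * (s * l)))) (k := K * s)
    (a₁ := c₀ * Real.exp (-(A₂ * K * (s * l)))) (a₂ := Real.exp (-(A₂ * K * (s * l))))
    (κ := Real.exp (-((A₁ + A₃ + 1 + 2 * θ) * (s * l)))) (δ := Real.exp (-(θ * s * l)))
    (βs := βs n) (ξs := activeSet (βs n))
    (C := contractionSet (X n) σs (βs n) (z₀ n) M₁ M₂ K (lam n) ε)
    hσs (by positivity) (by positivity) (by positivity) (by positivity) (Real.exp_pos _)
    (Real.exp_pos _) ?_ ?_ ?_ ?_ ?_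
  rotate_left
  · intro ζ hζ
    exact stdGaussian_compl_goodNoise_le_exp (X n) hε0 hL ht0.le ht2 hεt hu0.le hu hτB hub
      (by rw [div_le_iff₀ hτ0] at hlu; linarith) hl0 (hcardγ ζ hζ)
  · intro σ ξ β e e' hσ hcard hξ hsp he he' heq
    refine mem_contractionSet_of_goodNoise hn hcol hσs hσ hε0 hb0.le hne hfull (hlam n) hlamn hξ
      hcard hsp (hz.trans ?_) he he' heq (by linarith [mul_nonneg ht0.le hε0]) hεM hMε hερ
      (by linarith) (by linarith)
    linarith [mul_nonneg hη0.le hε0]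
  · classical
    refine (measure_mono fun θ hθ => ?_).trans ((prior_model_le hprior.variance_density
      (hprior.spike_prob n) (hprior.slab_density n) (hprior.model_nonneg n) hπ0
      (Finset.univ.filter fun ξ : Finset (Fin (p n)) => K * s < (ξ.card : ℝ))).trans
      (ENNReal.ofReal_le_ofReal ?_))
    · simp only [Set.mem_ofPred_eq, not_le, Finset.mem_filter, Finset.mem_univ, true_and] at hθ ⊢
      exact hθ.trans_le (by exact_mod_cast Finset.card_le_card Finset.sdiff_subset)
    · have h1 := htail (K * s) hKs
      have h2 : (p n : ℝ) ^ (-(A₂ * (K * s))) = Real.exp (-(A₂ * K * (s * l))) := by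
        rw [natCast_rpow_eq_exp hp, ← hldef]; ring_nf
      rw [h2] at h1
      rw [div_eq_inv_mul]
      exact mul_le_mul hπc h1 (Finset.sum_nonneg fun ξ _ => hprior.model_nonneg n ξ) hc₀.le
  · refine (prior_spike_le hprior.variance_density
      (hprior.spike_prob n) (hprior.slab_density n) (hprior.model_nonneg n) hπ0 (z₀ n)).trans ?_
    have := hprior.spike_prob n
    rw [← ofReal_measureReal, ← ENNReal.ofReal_natCast, ← ENNReal.ofReal_mul hp'.le]
    refine ENNReal.ofReal_le_ofReal (le_trans ?_ hpn)
    gcongr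
  · intro e Y hY hgood
    exact exp_mul_likelihood_le_evidence hprior.variance_density (hprior.spike_prob n)
      (hprior.slab_density n) (hprior.model_nonneg n) (hprior.model_sum n) hπ0 hcol hn hnp hσs hfull
      hs hl1 hε1 hη0.le hη1.le ht0.le (by linarith [mul_nonneg ht0.le hε0]) hb0.le hη4.le hz
      hc0.le hc (d := d₀⁻¹) (by positivity) hslab' htrue hstail (hpn.trans hhalf) (hℓ l hlℓ s hs) hKs hY
      hgood
  have hsum := error_sum_le (w := A₂ * K) (D := A₁ + A₃ + 1) (c := c₀) hp hldef hs hK0.le hKB hτ0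
    hθ0 hAB (by rw [hθdef]; ring) hc₀.le (by rw [div_le_iff₀ hτ0] at hlK; linarith)
    (by rw [div_le_iff₀ (lt_min (by linarith) hθ0)] at hlc; linarith) hl0
  have hbad := hbound.trans (ENNReal.ofReal_le_ofReal hsum)
  have hbad' := ENNReal.toReal_le_of_le_ofReal (Real.exp_pos _).le hbad
  set S := {Y : Fin n → ℝ | 1 - Real.exp (-(θ * s * l)) ≤
    (posteriorLaw (X n) g (π n) (h₀ n) (h₁ n) Y).real
      (contractionSet (X n) σs (βs n) (z₀ n) M₁ M₂ K (lam n) ε)} with hS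
  have hun := measureReal_union_le (μ := dataLaw (X n) σs (βs n)) S Sᶜ
  rw [Set.union_compl_self, probReal_univ] at hun
  have hSc : (dataLaw (X n) σs (βs n)).real Sᶜ ≤ Real.exp (-(min (τ / 2) θ * s * l)) := hbad'
  linarith
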